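/- Let $\mathsf H_1,\mathsf H_0$ be complex Hilbert spaces with $\mathsf H_1\subseteq\mathsf H_0$, the embedding being continuous. Let $A$ be a self-adjoint (possibly unbounded) operator in $\mathsf H_1$, and suppose that $A$ extends to a self-adjoint operator in $\mathsf H_0$ whose domain contains $\mathsf H_1$. Let $\Phi^A(t)$ be the strongly continuous unitary group on $\mathsf H_1$ generated by $-iA$. Let $B:\mathsf H_1\to\mathsf H_1$ be locally Lipschitz, and suppose that there is a map $B'$ from $\mathsf H_1$ to the bounded real-linear operators on $\mathsf H_0$ such that for all $R,\varepsilon>0$ there are $C,\delta>0$ with $$\|B'(u)\|\le C,\qquad \|B(u+w)-B(u)-B'(u)w\|_{\mathsf H_0}\le\varepsilon\|w\|_{\mathsf H_0}$$ for all $u,w\in\mathsf H_1$ with $\|u\|_{\mathsf H_1}\le R$ and $\|w\|_{\mathsf H_1}<\delta$. Let $\alpha,\beta:\mathbb R\to\mathbb R$ be bounded, locally integrable and periodic with a common period $\tau>0$, with $\frac1\tau\int_0^\tau\alpha=\frac1\tau\int_0^\tau\beta=1$. Put $\alpha_n(t)=\alpha(nt)$ and $\beta_n(t)=\beta(nt)$.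 For $u_0\in\mathsf H_1$ let $t\mapsto\Phi(t)u_0$ be the continuous $\mathsf H_1$-valued solution, with maximal existence time $T^*(u_0)$, of $$u(t)=\Phi^A(t)u_0-i\int_0^t\Phi^A(t-s)B(u(s))\,ds,$$ and let $t\mapsto\Phi_n(t)u_0$ be the continuous $\mathsf H_1$-valued solution, with maximal existence time $T_n^*(u_0)$, of $$u_n(t)=\Phi^A\Big(\int_0^t\alpha_n\Big)u_0-i\int_0^t\beta_n(s)\,\Phi^A\Big(\int_s^t\alpha_n\Big)B(u_n(s))\,ds.$$ Let $\theta\in(0,1)$ and let $\mathsf H_\theta=[\mathsf H_0,\mathsf H_1]_\theta$ be the complex interpolation space. Then for all $u_0\in\mathsf H_1$, $0<T<T^*(u_0)$ and $\varepsilon>0$ there is $n_0\in\mathbb N$ such that for every $n\ge n_0$, with $h_n=T/n$, one has $T<T_n^*(u_0)$ and $$\max_{0\le k\le n}\|\Phi(kh_n)u_0-\Phi_n(kh_n)u_0\|_{\mathsf H_\theta}\le\varepsilon\,h_n^{1-\theta}.$$ -/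

import Mathlib

open Set Filter Topology MeasureTheory
open scoped NNReal ENNReal

noncomputable section

/-- `U` is the strongly continuous one-parameter unitary group on `H` with infinitesimal
generator `-iA`: the generator has exactly the domain of `A` and equals `-iA` there. -/
structure IsUnitaryGroupGeneratedBy {H : Type*} [NormedAddCommGroup H] [InnerProductSpace ℂ H]
    (A : H →ₗ.[ℂ] H) (U : ℝ → H →L[ℂ] H) : Prop where
  map_zero : U 0 = ContinuousLinearMap.id ℂ H
  map_add : ∀ s t : ℝ, U (s + t) = (U s).comp (U t)
  norm_map : ∀ (t : ℝ) (x : H), ‖U t x‖ = ‖x‖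
  strongly_continuous : ∀ x : H, Continuous fun t : ℝ => U t x
  generator : ∀ x y : H,
    (x, y) ∈ A.graph ↔ HasDerivAt (fun t : ℝ => U t x) (-(Complex.I • y)) 0

open Classical in
/-- The group `Φ^A`. For self-adjoint `A` there is exactly one group generated by `-iA`
(Stone); the default value is only used for operators without such a group. -/
def unitaryGroup {H : Type*} [NormedAddCommGroup H] [InnerProductSpace ℂ H]
    (A : H →ₗ.[ℂ] H) : ℝ → H →L[ℂ] H :=
  if h : ∃ U : ℝ → H →L[ℂ] H, IsUnitaryGroupGeneratedBy A U then h.choose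
  else fun _ => ContinuousLinearMap.id ℂ H

/-- `u` is a continuous solution on `[0, T]` of the integral form of
`u' + i (α(t) A u + β(t) B(u)) = 0`, `u(0) = u₀`, that is, of
`u(t) = Φ^A(∫₀ᵗ α) u₀ - i ∫₀ᵗ β(s) Φ^A(∫ₛᵗ α) B(u(s)) ds`.
For `α = β = 1` this is the Duhamel equation of `u' + i A u + i B(u) = 0`. -/
structure IsMildSolutionOn {H : Type*} [NormedAddCommGroup H] [InnerProductSpace ℂ H]
    (A : H →ₗ.[ℂ] H) (B : H → H) (α β : ℝ → ℝ) (u₀ : H) (T : ℝ) (u : ℝ → H) : Prop where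
  continuousOn : ContinuousOn u (Icc 0 T)
  duhamel : ∀ t ∈ Icc (0 : ℝ) T,
    u t = unitaryGroup A (∫ r in (0 : ℝ)..t, α r) u₀ -
      Complex.I • ∫ s in (0 : ℝ)..t, β s • unitaryGroup A (∫ r in s..t, α r) (B (u s))

/-- The maximal existence time: the supremum of all `T` such that a solution exists
on `[0, T]`. -/
def existenceTime {H : Type*} [NormedAddCommGroup H] [InnerProductSpace ℂ H]
    (A : H →ₗ.[ℂ] H) (B : H → H) (α β : ℝ → ℝ) (u₀ : H) : ℝ≥0∞ :=
  ⨆ (T : ℝ≥0) (_ : ∃ u : ℝ → H, IsMildSolutionOn A B α β u₀ T u), (T : ℝ≥0∞)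

open Classical in
/-- The flow: the value at time `t` of the solution starting at `u₀` (a junk value if the
solution does not exist up to time `t`). -/
def flow {H : Type*} [NormedAddCommGroup H] [InnerProductSpace ℂ H]
    (A : H →ₗ.[ℂ] H) (B : H → H) (α β : ℝ → ℝ) (t : ℝ) (u₀ : H) : H :=
  if h : ∃ u : ℝ → H, IsMildSolutionOn A B α β u₀ t u then h.choose t else 0

/-- The exact flow `Φ(t) u₀` of `u' + i A u + i B(u) = 0`. -/
def exactFlow {H : Type*} [NormedAddCommGroup H] [InnerProductSpace ℂ H]
    (A : H →ₗ.[ℂ] H) (B : H → H) (t : ℝ) (u₀ : H) : H :=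
  flow A B (fun _ => 1) (fun _ => 1) t u₀

/-- The maximal existence time `T^*(u₀)` of `u' + i A u + i B(u) = 0`. -/
def exactExistenceTime {H : Type*} [NormedAddCommGroup H] [InnerProductSpace ℂ H]
    (A : H →ₗ.[ℂ] H) (B : H → H) (u₀ : H) : ℝ≥0∞ :=
  existenceTime A B (fun _ => 1) (fun _ => 1) u₀

/-- The splitting flow `Φ_n(t) u₀`, with `α_n(t) = α(n t)` and `β_n(t) = β(n t)`. -/
def splittingFlow {H : Type*} [NormedAddCommGroup H] [InnerProductSpace ℂ H]
    (A : H →ₗ.[ℂ] H) (B : H → H) (α β : ℝ → ℝ) (n : ℕ) (t : ℝ) (u₀ : H) : H :=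
  flow A B (fun s => α (n * s)) (fun s => β (n * s)) t u₀

/-- The maximal existence time of the splitting flow `Φ_n(t) u₀`. -/
def splittingExistenceTime {H : Type*} [NormedAddCommGroup H] [InnerProductSpace ℂ H]
    (A : H →ₗ.[ℂ] H) (B : H → H) (α β : ℝ → ℝ) (n : ℕ) (u₀ : H) : ℝ≥0∞ :=
  existenceTime A B (fun s => α (n * s)) (fun s => β (n * s)) u₀

/-- `p` is an admissible time profile: locally integrable, bounded, periodic with period `τ`,
and of mean value one. -/
structure IsSplittingProfile (τ : ℝ) (p : ℝ → ℝ) : Prop where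
  locallyIntegrable : LocallyIntegrable p volume
  bounded : ∃ M : ℝ, ∀ t : ℝ, |p t| ≤ M
  periodic : Function.Periodic p τ
  mean_one : τ⁻¹ * ∫ t in (0 : ℝ)..τ, p t = 1

/-- The pair `(f, g)` belongs to Calderón's function space on the strip `0 ≤ Re z ≤ 1` for the
couple `(H₀, H₁)`, where `H₁` is embedded in `H₀` by `ι`, and has norm at most `M` there.
Since `H₁` is continuously embedded in `H₀`, the sum `H₀ + H₁` is `H₀`, with an equivalent norm.
The function `g` is the boundary value of `f` on `Re z = 1`, as an `H₁`-valued function. -/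
structure IsCalderonFunction {H₀ H₁ : Type*}
    [NormedAddCommGroup H₀] [InnerProductSpace ℂ H₀]
    [NormedAddCommGroup H₁] [InnerProductSpace ℂ H₁]
    (ι : H₁ →L[ℂ] H₀) (f : ℂ → H₀) (g : ℝ → H₁) (M : ℝ) : Prop where
  continuousOn : ContinuousOn f {z : ℂ | 0 ≤ z.re ∧ z.re ≤ 1}
  bounded : ∃ K : ℝ, ∀ z : ℂ, 0 ≤ z.re → z.re ≤ 1 → ‖f z‖ ≤ K
  holomorphic : DifferentiableOn ℂ f {z : ℂ | 0 < z.re ∧ z.re < 1}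
  boundary_one : ∀ t : ℝ, f (1 + t * Complex.I) = ι (g t)
  continuous_one : Continuous g
  tendsto_zero : Tendsto (fun t : ℝ => f (t * Complex.I)) (cocompact ℝ) (𝓝 0)
  tendsto_one : Tendsto g (cocompact ℝ) (𝓝 0)
  norm_zero_le : ∀ t : ℝ, ‖f (t * Complex.I)‖ ≤ M
  norm_one_le : ∀ t : ℝ, ‖g t‖ ≤ M

/-- The norm of the complex interpolation space `[H₀, H₁]_θ`, as an extended norm on `H₀`:
the infimum of the Calderón norms of the `f` with `f(θ) = x`. It is `∞` exactly when `x` does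
not lie in `[H₀, H₁]_θ`. -/
def interpolationENorm {H₀ H₁ : Type*}
    [NormedAddCommGroup H₀] [InnerProductSpace ℂ H₀]
    [NormedAddCommGroup H₁] [InnerProductSpace ℂ H₁]
    (ι : H₁ →L[ℂ] H₀) (θ : ℝ) (x : H₀) : ℝ≥0∞ :=
  ⨅ (M : ℝ≥0) (_ : ∃ (f : ℂ → H₀) (g : ℝ → H₁), IsCalderonFunction ι f g M ∧ f θ = x),
    (M : ℝ≥0∞)

/-- The map `B'` is a derivative of `B` with respect to the norm of `H₀`, uniformly on bounded
subsets of `H₁`. The operators `B'(u)` are bounded and real-linear on `H₀`. -/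
def IsUniformH0Derivative {H₀ H₁ : Type*}
    [NormedAddCommGroup H₀] [InnerProductSpace ℂ H₀]
    [NormedAddCommGroup H₁] [InnerProductSpace ℂ H₁]
    (ι : H₁ →L[ℂ] H₀) (B : H₁ → H₁) (B' : H₁ → H₀ →L[ℝ] H₀) : Prop :=
  ∀ R > (0 : ℝ), ∀ ε > (0 : ℝ), ∃ C > (0 : ℝ), ∃ δ > (0 : ℝ), ∀ u w : H₁, ‖u‖ ≤ R → ‖w‖ < δ →
    ‖B' u‖ ≤ C ∧ ‖ι (B (u + w)) - ι (B u) - B' u (ι w)‖ ≤ ε * ‖ι w‖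

end

/-! The rate comes from interpolating between two bounds for the splitting solution $u_n$ against
the exact solution $u$, both uniform on some $[0,T']$ with $T'>T$: the $\mathsf H_1$ norm of $u_n-u$
is $o(1)$ and its $\mathsf H_0$ norm is $O(1/n)$. Since $\|x\|_{\mathsf H_\theta}\le
e\,\|x\|_{\mathsf H_0}^{1-\theta}\|x\|_{\mathsf H_1}^{\theta}$ (`interpolationENorm_embedding_le`),
the difference is $o(n^{-(1-\theta)})$ in $\mathsf H_\theta$.

Both bounds rest on averaging (`norm_integral_smul_le_of_periodic`). As $\alpha_n-1$ and $\beta_n-1$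
have mean zero over the period $\tau/n$, one has $\int_0^t\alpha_n=t+O(1/n)$, and
$\int_0^t(\beta_n-1)G$ is controlled by the oscillation of $G$ over one period, where
$G(s)=\Phi^A(-s)B(u(s))$.

In $\mathsf H_1$ the function $G$ is merely continuous, so $u$ is a fixed point of the splitting
Picard operator up to $o(1)$ (`exists_norm_picardMap_sub_le`). Picard iteration started at $u$ then
yields $u_n$ on all of $[0,T']$, close to $u$ (`exists_eq_picardMap`).

In $\mathsf H_0$ the function $G$ is Lipschitz: the extension of $A$ is bounded from $\mathsf H_1$
to $\mathsf H_0$ by the closed graph theorem, and $B$ is locally Lipschitz for the $\mathsf H_0$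
norm. Since $\Phi^A$ also preserves the $\mathsf H_0$ norm, Grönwall gives $O(1/n)$
(`exists_norm_embedding_sub_le_div`).

That the group $\Phi^A$ exists is Stone's theorem, proved by bounded skew-adjoint approximations. -/

noncomputable section

/-! ### Unitary groups and the Picard operator -/

section Group

variable {H : Type*} [NormedAddCommGroup H] [InnerProductSpace ℂ H]
  {A : H →ₗ.[ℂ] H} {U : ℝ → H →L[ℂ] H}

namespace IsUnitaryGroupGeneratedBy

theorem map_add_apply (hU : IsUnitaryGroupGeneratedBy A U) (s t : ℝ) (x : H) :
    U (s + t) x = U s (U t x) := by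
  rw [hU.map_add]; rfl

theorem continuous_uncurry (hU : IsUnitaryGroupGeneratedBy A U) :
    Continuous fun p : ℝ × H => U p.1 p.2 := by
  rw [continuous_iff_continuousAt]
  rintro ⟨t, x⟩
  rw [ContinuousAt, tendsto_iff_norm_sub_tendsto_zero]
  have h1 : Tendsto (fun p : ℝ × H => ‖p.2 - x‖ + ‖U p.1 x - U t x‖) (𝓝 (t, x)) (𝓝 0) := by
    have hc : Continuous fun p : ℝ × H => ‖p.2 - x‖ + ‖U p.1 x - U t x‖ := by
      have := (hU.strongly_continuous x).comp (continuous_fst (X := ℝ) (Y := H))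
      exact (continuous_snd.sub continuous_const).norm.add (this.sub continuous_const).norm
    simpa using hc.tendsto (t, x)
  refine squeeze_zero (fun _ => norm_nonneg _) (fun p => ?_) h1
  calc ‖U p.1 p.2 - U t x‖ = ‖U p.1 (p.2 - x) + (U p.1 x - U t x)‖ := by
        rw [map_sub]; congr 1; abel
    _ ≤ ‖p.2 - x‖ + ‖U p.1 x - U t x‖ := by
        rw [← hU.norm_map p.1 (p.2 - x)]; exact norm_add_le _ _

theorem continuousOn_comp (hU : IsUnitaryGroupGeneratedBy A U) {a : ℝ → ℝ} {v : ℝ → H} {s : Set ℝ}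
    (ha : ContinuousOn a s) (hv : ContinuousOn v s) : ContinuousOn (fun t => U (a t) (v t)) s :=
  hU.continuous_uncurry.comp_continuousOn (ha.prodMk hv)

end IsUnitaryGroupGeneratedBy

/-- The Picard operator of the integral equation, with the propagator factored as
`Φ^A(∫ₛᵗ α) = U(a(t)) U(-a(s))`, where `a` is a primitive of `α`. -/
def picardMap (U : ℝ → H →L[ℂ] H) (B : H → H) (a β : ℝ → ℝ) (u₀ : H) (v : ℝ → H) (t : ℝ) : H :=
  U (a t) (u₀ - Complex.I • ∫ s in (0 : ℝ)..t, β s • U (-a s) (B (v s)))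

variable {B : H → H} {α a β : ℝ → ℝ} {u₀ : H} {T : ℝ} {v w : ℝ → H}

theorem intervalIntegrable_picard (hU : IsUnitaryGroupGeneratedBy A U)
    (ha : Continuous a) (hβ : ∀ s t, IntervalIntegrable β volume s t)
    {g : ℝ → H} (hg : ContinuousOn g (Icc 0 T)) {s t : ℝ} (hs : s ∈ Icc 0 T) (ht : t ∈ Icc 0 T) :
    IntervalIntegrable (fun s => β s • U (-a s) (g s)) volume s t := by
  refine (hβ s t).smul_continuousOn ?_
  exact hU.continuousOn_comp ha.neg.continuousOn (hg.mono (uIcc_subset_Icc hs ht))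

theorem continuousOn_picardMap (hU : IsUnitaryGroupGeneratedBy A U)
    (ha : Continuous a) (hβ : ∀ s t, IntervalIntegrable β volume s t) (hT : 0 ≤ T)
    (hv : ContinuousOn (fun s => B (v s)) (Icc 0 T)) :
    ContinuousOn (picardMap U B a β u₀ v) (Icc 0 T) := by
  have h0 : (0 : ℝ) ∈ Icc 0 T := ⟨le_rfl, hT⟩
  have hI := intervalIntegrable_picard hU ha hβ hv h0 (⟨hT, le_rfl⟩ : T ∈ Icc 0 T)
  have := intervalIntegral.continuousOn_primitive_interval' hI (left_mem_uIcc)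
  rw [uIcc_of_le hT] at this
  exact hU.continuousOn_comp ha.continuousOn (continuousOn_const.sub (this.const_smul _))

/-- By the group law the factor at time `t` comes out of the integral, so `t` survives inside only
as the upper limit. -/
theorem isMildSolutionOn_iff [CompleteSpace H] (hU : IsUnitaryGroupGeneratedBy A (unitaryGroup A))
    (hα : ∀ s t, IntervalIntegrable α volume s t) (hβ : ∀ s t, IntervalIntegrable β volume s t)
    (hB : Continuous B) :
    IsMildSolutionOn A B α β u₀ T v ↔ ContinuousOn v (Icc 0 T) ∧ ∀ t ∈ Icc 0 T,
      v t = picardMap (unitaryGroup A) B (fun t => ∫ r in (0 : ℝ)..t, α r) β u₀ v t := by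
  have key : ContinuousOn v (Icc 0 T) → ∀ t ∈ Icc 0 T,
      picardMap (unitaryGroup A) B (fun t => ∫ r in (0 : ℝ)..t, α r) β u₀ v t =
      unitaryGroup A (∫ r in (0 : ℝ)..t, α r) u₀ -
      Complex.I • ∫ s in (0 : ℝ)..t, β s • unitaryGroup A (∫ r in s..t, α r) (B (v s)) := by
    intro hv t ht
    have ha : Continuous fun t => ∫ r in (0 : ℝ)..t, α r :=
      intervalIntegral.continuous_primitive hα 0
    have hI := intervalIntegrable_picard hU ha hβ (hB.comp_continuousOn hv)
      (⟨le_rfl, ht.1.trans ht.2⟩ : (0 : ℝ) ∈ Icc 0 T) ht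
    simp only [Function.comp_apply] at hI
    simp only [picardMap, map_sub, map_smul]
    rw [← ContinuousLinearMap.intervalIntegral_comp_comm _ hI]
    congr 3
    ext s
    rw [← intervalIntegral.integral_interval_sub_left (hα 0 t) (hα 0 s), sub_eq_add_neg,
      hU.map_add_apply]
    exact (map_smul ((unitaryGroup A _).restrictScalars ℝ) (β s) _)
  constructor
  · intro h
    exact ⟨h.continuousOn, fun t ht => (h.duhamel t ht).trans (key h.continuousOn t ht).symm⟩
  · intro h
    exact ⟨h.1, fun t ht => (h.2 t ht).trans (key h.1 t ht)⟩

/-- Both propagators are isometries and drop out, so the bound does not see the primitive `a` and is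
uniform in `n` when applied to the splitting. -/
theorem norm_picardMap_sub_le (hU : IsUnitaryGroupGeneratedBy A U)
    (ha : Continuous a) (hβ : ∀ s t, IntervalIntegrable β volume s t) {M L : ℝ}
    (hM : ∀ t, |β t| ≤ M)
    (hv : ContinuousOn (fun s => B (v s)) (Icc 0 T))
    (hw : ContinuousOn (fun s => B (w s)) (Icc 0 T))
    {f : ℝ → ℝ} (hf : ContinuousOn f (Icc 0 T))
    (hL : ∀ t ∈ Icc 0 T, ‖B (v t) - B (w t)‖ ≤ L * f t) {t : ℝ} (ht : t ∈ Icc 0 T) :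
    ‖picardMap U B a β u₀ v t - picardMap U B a β u₀ w t‖ ≤
      M * L * ∫ s in (0 : ℝ)..t, f s := by
  have h0 : (0 : ℝ) ∈ Icc 0 T := ⟨le_rfl, ht.1.trans ht.2⟩
  rw [picardMap, picardMap, ← map_sub, hU.norm_map, sub_sub_sub_cancel_left, ← smul_sub,
    norm_smul, Complex.norm_I, one_mul, ← intervalIntegral.integral_sub
      (intervalIntegrable_picard hU ha hβ hw h0 ht) (intervalIntegrable_picard hU ha hβ hv h0 ht),
    ← intervalIntegral.integral_const_mul]
  refine intervalIntegral.norm_integral_le_of_norm_le ht.1 (ae_of_all _ fun s hs => ?_)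
    (((hf.mono (uIcc_subset_Icc h0 ht)).intervalIntegrable).const_mul _)
  have hs' : s ∈ Icc 0 T := ⟨hs.1.le, hs.2.trans ht.2⟩
  rw [← smul_sub, ← map_sub, norm_smul, hU.norm_map, Real.norm_eq_abs, mul_assoc, norm_sub_rev]
  exact mul_le_mul (hM s) (hL s hs') (norm_nonneg _) ((abs_nonneg _).trans (hM s))

end Group

/-! ### Grönwall, averaging, and Lipschitz bounds near compact sets -/

/-- An integral form of Grönwall's inequality. -/
theorem le_of_le_add_integral {f : ℝ → ℝ} {T c K : ℝ} (hf : ContinuousOn f (Icc 0 T))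
    (hf0 : ∀ t ∈ Icc 0 T, 0 ≤ f t) (hK : 0 < K)
    (h : ∀ t ∈ Icc 0 T, f t ≤ c + K * ∫ s in (0 : ℝ)..t, f s) (hc : 0 ≤ c) :
    ∀ t ∈ Icc 0 T, f t ≤ 2 * c * Real.exp (2 * K * T) := by
  intro t ht
  have hT : 0 ≤ T := ht.1.trans ht.2
  -- Let $D$ be the maximum of $f(t)e^{-2Kt}$. At the maximiser the integral term is at most half of
  -- $De^{2Km}$ and is absorbed, whence $D\le 2c$; the rate $2K$ in place of $K$ leaves room for
  -- this.
  obtain ⟨m, hm, hmax⟩ := isCompact_Icc.exists_isMaxOn (nonempty_Icc.2 hT)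
    (hf.mul (f := f) (g := fun t => Real.exp (-(2 * K * t))) (by fun_prop))
  set D := f m * Real.exp (-(2 * K * m)) with hD
  have hle : ∀ s ∈ Icc 0 T, f s ≤ D * Real.exp (2 * K * s) := by
    intro s hs
    have : f s * Real.exp (-(2 * K * s)) ≤ D := hmax hs
    rwa [Real.exp_neg, ← div_eq_mul_inv, div_le_iff₀ (Real.exp_pos _)] at this
  have hint : ∫ s in (0 : ℝ)..m, D * Real.exp (2 * K * s) =
      D * ((Real.exp (2 * K * m) - 1) / (2 * K)) := by
    rw [intervalIntegral.integral_const_mul, intervalIntegral.integral_comp_mul_left _ (by positivity)]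
    simp [integral_exp, div_eq_inv_mul]
  have h0 : (0 : ℝ) ∈ Icc 0 T := ⟨le_rfl, hT⟩
  have hfm : f m ≤ c + K * (D * ((Real.exp (2 * K * m) - 1) / (2 * K))) := by
    rw [← hint]
    refine (h m hm).trans ?_
    gcongr
    refine intervalIntegral.integral_mono_on hm.1
      (hf.mono (uIcc_subset_Icc h0 hm)).intervalIntegrable
      (Continuous.intervalIntegrable (by fun_prop) _ _)
      fun s hs => hle s ⟨hs.1, hs.2.trans hm.2⟩
  have hD0 : 0 ≤ D := mul_nonneg (hf0 m hm) (Real.exp_pos _).le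
  have hfm' : f m = D * Real.exp (2 * K * m) := by
    rw [hD, mul_assoc, ← Real.exp_add]; simp
  have he : 1 ≤ Real.exp (2 * K * m) := Real.one_le_exp (by have := hm.1; positivity)
  have hDc : D ≤ 2 * c := by
    have : K * (D * ((Real.exp (2 * K * m) - 1) / (2 * K))) = D * (Real.exp (2 * K * m) - 1) / 2 := by
      field_simp
    rw [this, hfm'] at hfm
    nlinarith [mul_nonneg hD0 (sub_nonneg.2 he), mul_nonneg hc (sub_nonneg.2 he)]
  calc f t ≤ D * Real.exp (2 * K * t) := hle t ht
    _ ≤ 2 * c * Real.exp (2 * K * T) := by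
      have := ht.2
      gcongr

/-- Averaging: the integral of a function of mean zero and small period against a slowly varying
function is small. -/
theorem norm_integral_smul_le_of_periodic {E : Type*} [NormedAddCommGroup E] [NormedSpace ℝ E]
    [CompleteSpace E] {b : ℝ → ℝ} {σ M : ℝ} (hσ : 0 < σ) (hb : Function.Periodic b σ)
    (hM : ∀ t, |b t| ≤ M) (hbi : ∀ s t, IntervalIntegrable b volume s t)
    (h0 : ∫ s in (0 : ℝ)..σ, b s = 0) {G : ℝ → E} {T K η : ℝ}
    (hG : ContinuousOn G (Icc 0 T)) (hK : ∀ t ∈ Icc 0 T, ‖G t‖ ≤ K)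
    (hη : ∀ s ∈ Icc 0 T, ∀ t ∈ Icc 0 T, s ≤ t → t ≤ s + σ → ‖G t - G s‖ ≤ η)
    {t : ℝ} (ht : t ∈ Icc 0 T) :
    ‖∫ s in (0 : ℝ)..t, b s • G s‖ ≤ M * (t * η + σ * K) := by
  have hM0 : 0 ≤ M := (abs_nonneg _).trans (hM 0)
  have hT : 0 ≤ T := ht.1.trans ht.2
  have h0T : (0 : ℝ) ∈ Icc 0 T := ⟨le_rfl, hT⟩
  have hη0 : 0 ≤ η := (norm_nonneg _).trans (hη 0 h0T 0 h0T le_rfl (by linarith))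
  have hK0 : 0 ≤ K := (norm_nonneg _).trans (hK 0 h0T)
  have hI : ∀ r ∈ Icc 0 T, ∀ s ∈ Icc 0 T, IntervalIntegrable (fun s => b s • G s) volume r s :=
    fun r hr s hs => (hbi r s).smul_continuousOn (hG.mono (uIcc_subset_Icc hr hs))
  have hper : ∀ r, ∫ s in r..(r + σ), b s = 0 := fun r => by
    rw [hb.intervalIntegral_add_eq r 0, zero_add, h0]
  -- On each full period `G` may be replaced by its increment from the left endpoint, because `b`
  -- integrates to zero there. The incomplete last period is bounded crudely by `M * K * σ`.
  have hN : ∀ N : ℕ, N * σ ≤ T → ‖∫ s in (0 : ℝ)..(N * σ), b s • G s‖ ≤ M * (N * σ * η) := by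
    intro N
    induction N with
    | zero => simp
    | succ N ih =>
      intro h
      push_cast at h ⊢
      have hNσ : (0 : ℝ) ≤ N * σ := by positivity
      have h1 : (N : ℝ) * σ ∈ Icc 0 T := ⟨hNσ, by nlinarith⟩
      have h2 : ((N : ℝ) + 1) * σ ∈ Icc 0 T := ⟨by positivity, h⟩
      rw [← intervalIntegral.integral_add_adjacent_intervals (hI _ h0T _ h1) (hI _ h1 _ h2)]
      have hle : (N : ℝ) * σ ≤ (N + 1) * σ := by nlinarith
      have hstep : ‖∫ s in (N * σ : ℝ)..((N + 1) * σ), b s • G s‖ ≤ M * η * σ := by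
        have hc : ∫ s in (N * σ : ℝ)..((N + 1) * σ), b s • G (N * σ) = 0 := by
          rw [intervalIntegral.integral_smul_const, add_mul, one_mul, hper, zero_smul]
        have hsub : ∫ s in (N * σ : ℝ)..((N + 1) * σ), b s • G s =
            ∫ s in (N * σ : ℝ)..((N + 1) * σ), b s • (G s - G (N * σ)) := by
          simp only [smul_sub]
          rw [intervalIntegral.integral_sub (hI _ h1 _ h2)
            ((hbi _ _).smul_continuousOn continuousOn_const), hc, sub_zero]
        rw [hsub]
        have := intervalIntegral.norm_integral_le_of_norm_le_const (a := (N * σ : ℝ))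
          (b := (N + 1) * σ) (C := M * η) (f := fun s => b s • (G s - G (N * σ))) ?_
        · refine this.trans_eq ?_
          rw [abs_of_nonneg (by linarith)]; ring
        · intro s hs
          rw [uIoc_of_le hle] at hs
          rw [norm_smul]
          exact mul_le_mul (hM s) (hη _ h1 _ ⟨hNσ.trans hs.1.le, hs.2.trans h⟩ hs.1.le
            (by linarith [hs.2])) (norm_nonneg _) hM0
      calc _ ≤ _ := norm_add_le _ _
        _ ≤ M * (N * σ * η) + M * η * σ := add_le_add (ih h1.2) hstep
        _ = _ := by ring
  set N := ⌊t / σ⌋₊ with hNdef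
  have hN1 : N * σ ≤ t := by
    rw [← le_div_iff₀ hσ]; exact Nat.floor_le (div_nonneg ht.1 hσ.le)
  have hN2 : t ≤ N * σ + σ := by
    have := (Nat.lt_floor_add_one (t / σ)).le
    rw [div_le_iff₀ hσ] at this
    linarith
  have h1 : (N : ℝ) * σ ∈ Icc 0 T := ⟨by positivity, hN1.trans ht.2⟩
  rw [← intervalIntegral.integral_add_adjacent_intervals (hI _ h0T _ h1) (hI _ h1 _ ht)]
  have hlast : ‖∫ s in (N * σ : ℝ)..t, b s • G s‖ ≤ M * K * σ := by
    have := intervalIntegral.norm_integral_le_of_norm_le_const (a := (N * σ : ℝ))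
      (b := t) (C := M * K) (f := fun s => b s • G s) ?_
    · refine this.trans ?_
      rw [abs_of_nonneg (by linarith)]
      gcongr
      linarith
    · intro s hs
      rw [uIoc_of_le hN1] at hs
      rw [norm_smul]
      exact mul_le_mul (hM s) (hK _ ⟨h1.1.trans hs.1.le, hs.2.trans ht.2⟩) (norm_nonneg _) hM0
  calc _ ≤ _ := norm_add_le _ _
    _ ≤ M * (N * σ * η) + M * K * σ := add_le_add (hN N h1.2) hlast
    _ ≤ M * (t * η) + M * K * σ := by gcongr
    _ = _ := by ring

/-- A locally Lipschitz map is Lipschitz on balls of a fixed radius around the points of a compact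
set, with a common constant. -/
theorem LocallyLipschitz.exists_lipschitz_near_isCompact {E F : Type*} [NormedAddCommGroup E]
    [NormedAddCommGroup F] {B : E → F} (hB : LocallyLipschitz B) {s : Set E} (hs : IsCompact s) :
    ∃ δ > (0 : ℝ), ∃ L > (0 : ℝ), ∀ p ∈ s, ∀ x y, ‖x - p‖ ≤ δ → ‖y - p‖ ≤ δ →
      ‖B x - B y‖ ≤ L * ‖x - y‖ := by
  refine hs.induction_on (p := fun s => ∃ δ > (0 : ℝ), ∃ L > (0 : ℝ), ∀ p ∈ s, ∀ x y,
    ‖x - p‖ ≤ δ → ‖y - p‖ ≤ δ → ‖B x - B y‖ ≤ L * ‖x - y‖) ?_ ?_ ?_ ?_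
  · exact ⟨1, one_pos, 1, one_pos, by simp⟩
  · rintro s t hst ⟨δ, hδ, L, hL, h⟩
    exact ⟨δ, hδ, L, hL, fun p hp => h p (hst hp)⟩
  · rintro s t ⟨δ, hδ, L, hL, h⟩ ⟨δ', hδ', L', hL', h'⟩
    refine ⟨min δ δ', lt_min hδ hδ', max L L', lt_max_of_lt_left hL, ?_⟩
    rintro p (hp | hp) x y hx hy
    · refine (h p hp x y (hx.trans (min_le_left _ _)) (hy.trans (min_le_left _ _))).trans ?_
      gcongr
      exact le_max_left _ _
    · refine (h' p hp x y (hx.trans (min_le_right _ _)) (hy.trans (min_le_right _ _))).trans ?_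
      gcongr
      exact le_max_right _ _
  · intro p hp
    obtain ⟨K, t, ht, hK⟩ := hB p
    obtain ⟨r, hr, hrt⟩ := Metric.mem_nhds_iff.1 ht
    refine ⟨Metric.ball p (r / 2), mem_nhdsWithin_of_mem_nhds (Metric.ball_mem_nhds p (by linarith)),
      r / 4, by linarith, K + 1, by positivity, fun q hq x y hx hy => ?_⟩
    have hmem : ∀ z, ‖z - q‖ ≤ r / 4 → z ∈ t := fun z hz => hrt <| by
      rw [Metric.mem_ball] at hq ⊢
      rw [← dist_eq_norm] at hz
      linarith [dist_triangle z q p]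
    refine (hK.norm_sub_le (hmem x hx) (hmem y hy)).trans ?_
    gcongr
    linarith

/-! ### Existence near an approximate solution, and uniqueness -/

section Picard

variable {H : Type*} [NormedAddCommGroup H] [InnerProductSpace ℂ H]
  {A : H →ₗ.[ℂ] H} {U : ℝ → H →L[ℂ] H} {B : H → H} {a β : ℝ → ℝ} {u₀ : H} {T : ℝ}

/-- An approximate fixed point of the Picard operator, around which the nonlinearity is Lipschitz,
is close to a fixed point. -/
theorem exists_eq_picardMap [CompleteSpace H] (hU : IsUnitaryGroupGeneratedBy A U)
    (ha : Continuous a) (hβ : ∀ s t, IntervalIntegrable β volume s t) {M L δ η : ℝ}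
    (hM : ∀ t, |β t| ≤ M) (hM0 : 0 < M) (hL0 : 0 < L) (hB : Continuous B) (hT : 0 ≤ T)
    {u : ℝ → H} (hu : ContinuousOn u (Icc 0 T))
    (hL : ∀ t ∈ Icc 0 T, ∀ x y, ‖x - u t‖ ≤ δ → ‖y - u t‖ ≤ δ → ‖B x - B y‖ ≤ L * ‖x - y‖)
    (hη : ∀ t ∈ Icc 0 T, ‖picardMap U B a β u₀ u t - u t‖ ≤ η)
    (hδ : 2 * η * Real.exp (2 * (M * L) * T) ≤ δ) :
    ∃ v : ℝ → H, ContinuousOn v (Icc 0 T) ∧ (∀ t ∈ Icc 0 T, v t = picardMap U B a β u₀ v t) ∧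
      ∀ t ∈ Icc 0 T, ‖v t - u t‖ ≤ 2 * η * Real.exp (2 * (M * L) * T) := by
  set c := 2 * (M * L) with hc
  have hML : 0 < M * L := mul_pos hM0 hL0
  have hη0 : 0 ≤ η := (norm_nonneg _).trans (hη 0 ⟨le_rfl, hT⟩)
  have hexp : ∀ t ∈ Icc 0 T, Real.exp (c * t) ≤ Real.exp (c * T) := fun t ht => by
    have := ht.2
    gcongr
  set V : ℕ → ℝ → H := fun k => (picardMap U B a β u₀)^[k] u with hV
  have hVs : ∀ k, V (k + 1) = picardMap U B a β u₀ (V k) := fun k =>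
    Function.iterate_succ_apply' _ _ _
  -- With the weight $e^{ct}$, $c=2ML$, each iteration halves the increment. The increments sum to
  -- at most $2\eta e^{cT}\le\delta$, so no iterate leaves the tube in which `B` is known to be
  -- Lipschitz.
  have hmain : ∀ k, ContinuousOn (V k) (Icc 0 T) ∧
      (∀ t ∈ Icc 0 T, ‖V k t - u t‖ ≤ 2 * η * (1 - (1 / 2) ^ k) * Real.exp (c * t)) ∧
      ∀ t ∈ Icc 0 T, ‖V (k + 1) t - V k t‖ ≤ η * (1 / 2) ^ k * Real.exp (c * t) := by
    intro k
    induction k with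
    | zero =>
      refine ⟨hu, fun t _ => by simp [hV], fun t ht => ?_⟩
      have h1 : 1 ≤ Real.exp (c * t) := Real.one_le_exp (mul_nonneg (by positivity) ht.1)
      refine (hη t ht).trans ?_
      simpa using le_mul_of_one_le_right hη0 h1
    | succ k ih =>
      obtain ⟨h1, h2, h3⟩ := ih
      have hcont : ContinuousOn (V (k + 1)) (Icc 0 T) := by
        rw [hVs]
        exact continuousOn_picardMap hU ha hβ hT (hB.comp_continuousOn h1)
      have htube : ∀ t ∈ Icc 0 T,
          ‖V (k + 1) t - u t‖ ≤ 2 * η * (1 - (1 / 2) ^ (k + 1)) * Real.exp (c * t) := by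
        intro t ht
        calc ‖V (k + 1) t - u t‖ = ‖(V (k + 1) t - V k t) + (V k t - u t)‖ := by congr 1; abel
          _ ≤ _ := norm_add_le _ _
          _ ≤ _ := add_le_add (h3 t ht) (h2 t ht)
          _ = _ := by ring
      have hin : ∀ j, ∀ t ∈ Icc 0 T, 2 * η * (1 - (1 / 2) ^ j) * Real.exp (c * t) ≤ δ := by
        intro j t ht
        refine le_trans ?_ hδ
        have : (0 : ℝ) ≤ (1 / 2) ^ j := by positivity
        have h' : 2 * η * (1 - (1 / 2) ^ j) ≤ 2 * η := by nlinarith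
        exact mul_le_mul h' (hexp t ht) (Real.exp_pos _).le (by positivity)
      refine ⟨hcont, htube, fun t ht => ?_⟩
      have := norm_picardMap_sub_le (u₀ := u₀) hU ha hβ hM (hB.comp_continuousOn hcont)
        (hB.comp_continuousOn h1) (L := L)
        (f := fun t => η * (1 / 2) ^ k * Real.exp (c * t)) (by fun_prop)
        (fun s hs => (hL s hs _ _ ((htube s hs).trans (hin _ s hs))
          ((h2 s hs).trans (hin _ s hs))).trans (by gcongr; exact h3 s hs)) ht
      rw [← hVs, ← hVs, intervalIntegral.integral_const_mul,
        intervalIntegral.integral_comp_mul_left (c := c) _ (by positivity)] at this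
      refine this.trans ?_
      simp only [mul_zero, integral_exp, Real.exp_zero, smul_eq_mul]
      have : M * L * (η * (1 / 2) ^ k * (c⁻¹ * (Real.exp (c * t) - 1))) =
        η * (1 / 2) ^ (k + 1) * (Real.exp (c * t) - 1) := by
        rw [hc, pow_succ]; field_simp
      rw [this]
      gcongr
      linarith
  have hdist : ∀ t ∈ Icc 0 T, ∀ k, dist (V k t) (V (k + 1) t) ≤
      η * Real.exp (c * T) * (1 / 2) ^ k := by
    intro t ht k
    rw [dist_comm, dist_eq_norm]
    refine ((hmain k).2.2 t ht).trans ?_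
    rw [mul_right_comm]
    gcongr
    exact ht.2
  have hlim : ∀ t, ∃ x, t ∈ Icc 0 T → Tendsto (fun k => V k t) atTop (𝓝 x) := by
    intro t
    by_cases ht : t ∈ Icc 0 T
    · obtain ⟨x, hx⟩ := cauchySeq_tendsto_of_complete
        (cauchySeq_of_le_geometric _ _ (by norm_num) (hdist t ht))
      exact ⟨x, fun _ => hx⟩
    · exact ⟨0, fun h => absurd h ht⟩
  choose v hv using hlim
  have hrate : ∀ t ∈ Icc 0 T, ∀ k, ‖V k t - v t‖ ≤ 2 * η * Real.exp (c * T) * (1 / 2) ^ k := by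
    intro t ht k
    rw [← dist_eq_norm]
    refine (dist_le_of_le_geometric_of_tendsto _ _ (by norm_num) (hdist t ht) (hv t ht) k).trans_eq ?_
    ring
  have hpow : Tendsto (fun k : ℕ => 2 * η * Real.exp (c * T) * (1 / 2) ^ k) atTop (𝓝 0) := by
    simpa using (tendsto_pow_atTop_nhds_zero_of_lt_one (r := (1 / 2 : ℝ)) (by norm_num)
      (by norm_num)).const_mul (2 * η * Real.exp (c * T))
  have hunif : TendstoUniformlyOn V v atTop (Icc 0 T) := by
    rw [Metric.tendstoUniformlyOn_iff]
    intro ε hε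
    filter_upwards [hpow.eventually (gt_mem_nhds hε)] with k hk t ht
    rw [dist_comm, dist_eq_norm]
    exact (hrate t ht k).trans_lt hk
  have hvc : ContinuousOn v (Icc 0 T) :=
    hunif.continuousOn (Frequently.of_forall fun k => (hmain k).1)
  have hVu : ∀ k, ∀ t ∈ Icc 0 T, ‖V k t - u t‖ ≤ 2 * η * Real.exp (c * T) := by
    intro k t ht
    refine ((hmain k).2.1 t ht).trans ?_
    have : (0 : ℝ) ≤ (1 / 2) ^ k := by positivity
    have h' : 2 * η * (1 - (1 / 2) ^ k) ≤ 2 * η := by nlinarith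
    exact mul_le_mul h' (hexp t ht) (Real.exp_pos _).le (by positivity)
  have hvu : ∀ t ∈ Icc 0 T, ‖v t - u t‖ ≤ 2 * η * Real.exp (c * T) := fun t ht =>
    le_of_tendsto ((hv t ht).sub_const _).norm (Eventually.of_forall fun k => hVu k t ht)
  refine ⟨v, hvc, fun t ht => ?_, hvu⟩
  have hlim1 : Tendsto (fun k => V (k + 1) t) atTop (𝓝 (v t)) :=
    (hv t ht).comp (tendsto_add_atTop_nat 1)
  refine tendsto_nhds_unique hlim1 ?_
  rw [tendsto_iff_norm_sub_tendsto_zero]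
  have hb : ∀ k, ‖V (k + 1) t - picardMap U B a β u₀ v t‖ ≤
      M * L * t * (2 * η * Real.exp (c * T) * (1 / 2) ^ k) := by
    intro k
    have := norm_picardMap_sub_le (u₀ := u₀) hU ha hβ hM (hB.comp_continuousOn (hmain k).1)
      (hB.comp_continuousOn hvc) (L := L)
      (f := fun _ => 2 * η * Real.exp (c * T) * (1 / 2) ^ k) (by fun_prop)
      (fun s hs => (hL s hs _ _ ((hVu k s hs).trans hδ)
        ((hvu s hs).trans hδ)).trans (by gcongr; exact hrate s hs k)) ht
    rw [← hVs, intervalIntegral.integral_const, smul_eq_mul, sub_zero] at this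
    exact this.trans_eq (by ring)
  refine squeeze_zero (fun _ => norm_nonneg _) hb ?_
  simpa using hpow.const_mul (M * L * t)

/-- Continuous fixed points of the Picard operator are unique. -/
theorem eqOn_of_eq_picardMap (hU : IsUnitaryGroupGeneratedBy A U)
    (ha : Continuous a) (hβ : ∀ s t, IntervalIntegrable β volume s t) {M : ℝ}
    (hM : ∀ t, |β t| ≤ M) (hM0 : 0 < M) (hB : LocallyLipschitz B)
    {u v : ℝ → H} (hu : ContinuousOn u (Icc 0 T)) (hv : ContinuousOn v (Icc 0 T))
    (hu' : ∀ t ∈ Icc 0 T, u t = picardMap U B a β u₀ u t)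
    (hv' : ∀ t ∈ Icc 0 T, v t = picardMap U B a β u₀ v t) : EqOn u v (Icc 0 T) := by
  -- The two trajectories are compact, so `B` has one Lipschitz constant on their union; Grönwall
  -- with `c = 0` finishes.
  obtain ⟨K, hK⟩ := (hB.locallyLipschitzOn (s := u '' Icc 0 T ∪ v '' Icc 0 T)
    ).exists_lipschitzOnWith_of_compact
    ((isCompact_Icc.image_of_continuousOn hu).union (isCompact_Icc.image_of_continuousOn hv))
  have hL : ∀ t ∈ Icc 0 T, ‖B (u t) - B (v t)‖ ≤ ((K : ℝ) + 1) * ‖u t - v t‖ := by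
    intro t ht
    refine (hK.norm_sub_le (Or.inl (mem_image_of_mem u ht))
      (Or.inr (mem_image_of_mem v ht))).trans ?_
    gcongr
    linarith
  intro t ht
  have hsub : ContinuousOn (fun t => ‖u t - v t‖) (Icc 0 T) := (hu.sub hv).norm
  have := le_of_le_add_integral (f := fun t => ‖u t - v t‖) (c := 0) (K := M * (K + 1))
    hsub (fun _ _ => norm_nonneg _) (by positivity) (fun t ht => by
      have := norm_picardMap_sub_le (u₀ := u₀) hU ha hβ hM (hB.continuous.comp_continuousOn hu)
        (hB.continuous.comp_continuousOn hv) hsub hL ht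
      rw [← hu' t ht, ← hv' t ht] at this
      simpa using this) le_rfl t ht
  rw [mul_zero, zero_mul] at this
  exact sub_eq_zero.1 (norm_le_zero_iff.1 this)

end Picard

/-! ### Averaging for the rescaled time profiles -/

namespace IsSplittingProfile

variable {τ M : ℝ} {p : ℝ → ℝ} {n : ℕ}

theorem intervalIntegrable (hp : IsSplittingProfile τ p) (s t : ℝ) :
    IntervalIntegrable p volume s t :=
  (hp.locallyIntegrable.integrableOn_isCompact isCompact_uIcc).intervalIntegrable

theorem intervalIntegrable_comp_mul (hp : IsSplittingProfile τ p) (hn : 0 < n) (s t : ℝ) :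
    IntervalIntegrable (fun s => p (n * s)) volume s t := by
  have hn' : (n : ℝ) ≠ 0 := by positivity
  have := (hp.intervalIntegrable (n * s) (n * t)).comp_mul_left (c := (n : ℝ))
  simpa [mul_div_cancel_left₀ _ hn'] using this

/-- The weight has period `τ / n`, mean zero, and absolute value at most `M + 1`. -/
theorem norm_integral_sub_one_smul_le (hp : IsSplittingProfile τ p) (hτ : 0 < τ)
    (hM : ∀ t, |p t| ≤ M) (hn : 0 < n) {E : Type*} [NormedAddCommGroup E] [NormedSpace ℝ E]
    [CompleteSpace E] {G : ℝ → E} {T K η : ℝ}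
    (hG : ContinuousOn G (Icc 0 T)) (hK : ∀ t ∈ Icc 0 T, ‖G t‖ ≤ K)
    (hη : ∀ s ∈ Icc 0 T, ∀ t ∈ Icc 0 T, s ≤ t → t ≤ s + τ / n → ‖G t - G s‖ ≤ η)
    {t : ℝ} (ht : t ∈ Icc 0 T) :
    ‖∫ s in (0 : ℝ)..t, (p (n * s) - 1) • G s‖ ≤ (M + 1) * (t * η + τ / n * K) := by
  have hn' : (0 : ℝ) < n := by positivity
  refine norm_integral_smul_le_of_periodic (b := fun s => p (n * s) - 1) (by positivity) ?_ ?_ ?_ ?_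
    hG hK hη ht
  · intro s
    simp only
    rw [mul_add, mul_div_cancel₀ _ hn'.ne', hp.periodic]
  · intro s
    refine (abs_sub _ _).trans ?_
    simpa using hM (n * s)
  · exact fun s t => (hp.intervalIntegrable_comp_mul hn s t).sub intervalIntegrable_const
  · rw [intervalIntegral.integral_sub (hp.intervalIntegrable_comp_mul hn _ _)
      intervalIntegrable_const, intervalIntegral.integral_comp_mul_left _ hn'.ne']
    have := hp.mean_one
    rw [inv_mul_eq_iff_eq_mul₀ hτ.ne', mul_one] at this
    rw [mul_zero, mul_div_cancel₀ _ hn'.ne', this]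
    simp [div_eq_inv_mul]

theorem abs_integral_sub_le (hp : IsSplittingProfile τ p) (hτ : 0 < τ)
    (hM : ∀ t, |p t| ≤ M) (hn : 0 < n) {t : ℝ} (ht : 0 ≤ t) :
    |(∫ s in (0 : ℝ)..t, p (n * s)) - t| ≤ (M + 1) * τ / n := by
  have := hp.norm_integral_sub_one_smul_le hτ hM hn (G := fun _ => (1 : ℝ)) (T := t) (K := 1)
    (η := 0) continuousOn_const (by simp) (by simp) ⟨ht, le_rfl⟩
  simp only [smul_eq_mul, mul_one, mul_zero, zero_add] at this
  rw [intervalIntegral.integral_sub (hp.intervalIntegrable_comp_mul hn _ _)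
      intervalIntegrable_const] at this
  simpa [mul_div_assoc] using this

end IsSplittingProfile

/-! ### The exact solution almost solves the splitting equation in the stronger norm -/

section Convergence

variable {H : Type*} [NormedAddCommGroup H] [InnerProductSpace ℂ H]
  {A : H →ₗ.[ℂ] H} {U : ℝ → H →L[ℂ] H} {B : H → H} {u₀ : H} {T : ℝ}

theorem IsUnitaryGroupGeneratedBy.norm_sub_eq (hU : IsUnitaryGroupGeneratedBy A U) (s t : ℝ)
    (x : H) : ‖U s x - U t x‖ = ‖U (s - t) x - x‖ := by
  rw [← hU.norm_map t (U (s - t) x - x), map_sub, ← hU.map_add_apply, add_sub_cancel]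

/-- The group need not be norm continuous, but joint continuity makes strong continuity uniform on
compact sets; it is applied along the trajectories of `z` and `B ∘ u`. -/
theorem IsUnitaryGroupGeneratedBy.exists_norm_sub_le_of_isCompact
    (hU : IsUnitaryGroupGeneratedBy A U) {K : Set H} (hK : IsCompact K) {η : ℝ} (hη : 0 < η) :
    ∃ δ > 0, ∀ s t, |s - t| ≤ δ → ∀ x ∈ K, ‖U s x - U t x‖ ≤ η := by
  have h := hK.eventually_forall_of_forall_eventually (x₀ := (0 : ℝ))
    (P := fun r x => ‖U r x - x‖ < η) fun x _ => by
      have hc : Continuous fun z : ℝ × H => ‖U z.1 z.2 - z.2‖ :=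
        (hU.continuous_uncurry.sub continuous_snd).norm
      exact hc.tendsto (0, x) |>.eventually (gt_mem_nhds (by simpa [hU.map_zero] using hη))
  obtain ⟨δ, hδ, h⟩ := Metric.eventually_nhds_iff.1 h
  refine ⟨δ / 2, by positivity, fun s t hst x hx => ?_⟩
  rw [hU.norm_sub_eq]
  refine (h ?_ x hx).le
  rw [Real.dist_eq, sub_zero]
  linarith

/-- The Picard operator of the splitting equation almost fixes the exact solution. -/
theorem exists_norm_picardMap_sub_le [CompleteSpace H] (hU : IsUnitaryGroupGeneratedBy A U)
    (hB : Continuous B) {τ : ℝ} {α β : ℝ → ℝ} (hτ : 0 < τ)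
    (hα : IsSplittingProfile τ α) (hβ : IsSplittingProfile τ β) (hT : 0 ≤ T) {u : ℝ → H}
    (hu : ContinuousOn u (Icc 0 T))
    (hu' : ∀ t ∈ Icc 0 T, u t = picardMap U B (fun t => t) (fun _ => 1) u₀ u t)
    {η : ℝ} (hη : 0 < η) :
    ∃ n₀ : ℕ, ∀ n : ℕ, n₀ ≤ n → ∀ t ∈ Icc 0 T,
      ‖picardMap U B (fun t => ∫ r in (0 : ℝ)..t, α (n * r)) (fun t => β (n * t)) u₀ u t - u t‖
        ≤ η := by
  obtain ⟨Mα, hMα⟩ := hα.bounded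
  obtain ⟨Mβ, hMβ⟩ := hβ.bounded
  have hMα0 : 0 ≤ Mα := (abs_nonneg _).trans (hMα 0)
  have hMβ0 : 0 ≤ Mβ := (abs_nonneg _).trans (hMβ 0)
  have h0 : (0 : ℝ) ∈ Icc 0 T := ⟨le_rfl, hT⟩
  set z : ℝ → H := fun t => u₀ - Complex.I • ∫ s in (0 : ℝ)..t, (1 : ℝ) • U (-s) (B (u s)) with hz
  have hg : ContinuousOn (fun s => B (u s)) (Icc 0 T) := hB.comp_continuousOn hu
  have hzc : ContinuousOn z (Icc 0 T) := by
    have hI := intervalIntegrable_picard hU continuous_id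
      (β := fun _ => 1) (fun _ _ => intervalIntegrable_const) hg h0 (⟨hT, le_rfl⟩ : T ∈ Icc 0 T)
    have := intervalIntegral.continuousOn_primitive_interval' hI (left_mem_uIcc)
    rw [uIcc_of_le hT] at this
    exact continuousOn_const.sub (this.const_smul _)
  have hGc : ContinuousOn (fun s => U (-s) (B (u s))) (Icc 0 T) :=
    hU.continuousOn_comp continuous_neg.continuousOn hg
  obtain ⟨K, hK⟩ := isCompact_Icc.exists_bound_of_continuousOn hGc
  have hK0 : 0 ≤ K := (norm_nonneg _).trans (hK 0 h0)
  -- Four errors of size at most `η / 4`: two governed by `η'` (shifted inner propagator,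
  -- oscillation of the integrand), the leftover period, and the shifted outer propagator.
  set η' : ℝ := η / (4 * ((Mβ + 1) * (T + 1))) with hη'
  have hη'0 : 0 < η' := by positivity
  obtain ⟨δ₁, hδ₁, h₁⟩ := hU.exists_norm_sub_le_of_isCompact
    (isCompact_Icc.image_of_continuousOn hzc) (show 0 < η / 4 by positivity)
  obtain ⟨δ₂, hδ₂, h₂⟩ := hU.exists_norm_sub_le_of_isCompact
    (isCompact_Icc.image_of_continuousOn hg) hη'0
  obtain ⟨δ₃, hδ₃, h₃⟩ := Metric.uniformContinuousOn_iff_le.1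
    (isCompact_Icc.uniformContinuousOn_of_continuous hGc) η' hη'0
  have hev : ∀ {c δ : ℝ}, 0 < δ → ∀ᶠ n : ℕ in atTop, c / n ≤ δ := fun {c δ} hδ =>
    (tendsto_const_div_atTop_nhds_zero_nat c).eventually (ge_mem_nhds hδ)
  obtain ⟨n₀, hn₀⟩ := eventually_atTop.1 ((eventually_gt_atTop 0).and
    ((hev (c := (Mα + 1) * τ) hδ₁).and ((hev (c := (Mα + 1) * τ) hδ₂).and
      ((hev (c := τ) hδ₃).and (hev (c := (Mβ + 1) * τ * K) (show 0 < η / 4 by positivity))))))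
  refine ⟨n₀, fun n hn t ht => ?_⟩
  obtain ⟨hn0, hn1, hn2, hn3, hn4⟩ := hn₀ n hn
  set a : ℝ → ℝ := fun t => ∫ r in (0 : ℝ)..t, α (n * r) with ha
  have hac : Continuous a :=
    intervalIntegral.continuous_primitive (hα.intervalIntegrable_comp_mul hn0) 0
  have hat : ∀ s ∈ Icc 0 T, |a s - s| ≤ (Mα + 1) * τ / n := fun s hs =>
    hα.abs_integral_sub_le hτ hMα hn0 hs.1
  have hβi := hβ.intervalIntegrable_comp_mul (n := n) hn0
  set zn : H := u₀ - Complex.I • ∫ s in (0 : ℝ)..t, β (n * s) • U (-a s) (B (u s)) with hzn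
  have hut : u t = U t (z t) := hu' t ht
  have hI1 := intervalIntegrable_picard hU hac hβi hg h0 ht
  have hI1' := intervalIntegrable_picard hU continuous_id hβi hg h0 ht
  have hI2 := intervalIntegrable_picard hU continuous_id
      (β := fun _ => 1) (fun _ _ => intervalIntegrable_const) hg h0 ht
  simp only [id] at hI1' hI2
  have hdiff : ‖zn - z t‖ ≤ Mβ * η' * t + (Mβ + 1) * (t * η' + τ / n * K) := by
    -- The time `a s` in the propagator is replaced by `s` before `β` is averaged, so that averaging
    -- acts on a function independent of `n`.
    have e1 : zn - z t = -(Complex.I • ((∫ s in (0 : ℝ)..t,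
        (β (n * s) • U (-a s) (B (u s)) - β (n * s) • U (-s) (B (u s)))) +
        ∫ s in (0 : ℝ)..t, (β (n * s) - 1) • U (-s) (B (u s)))) := by
      simp only [sub_smul]
      rw [intervalIntegral.integral_sub hI1 hI1', intervalIntegral.integral_sub hI1' hI2, hz, hzn]
      simp only [smul_sub, smul_add]
      abel
    rw [e1, norm_neg, norm_smul, Complex.norm_I, one_mul]
    refine (norm_add_le _ _).trans (add_le_add ?_ ?_)
    · have := intervalIntegral.norm_integral_le_of_norm_le_const (a := (0 : ℝ)) (b := t)
        (C := Mβ * η') (f := fun s => β (n * s) • U (-a s) (B (u s)) - β (n * s) • U (-s) (B (u s)))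
        fun s hs => by
          rw [uIoc_of_le ht.1] at hs
          have hs' : s ∈ Icc 0 T := ⟨hs.1.le, hs.2.trans ht.2⟩
          rw [← smul_sub, norm_smul]
          refine mul_le_mul (hMβ _) (h₂ _ _ ?_ _ (mem_image_of_mem _ hs')) (norm_nonneg _) hMβ0
          rw [neg_sub_neg, abs_sub_comm]
          exact (hat s hs').trans hn2
      rwa [sub_zero, abs_of_nonneg ht.1] at this
    · exact hβ.norm_integral_sub_one_smul_le hτ hMβ hn0 hGc hK (fun r hr s hs hrs hsr => by
        rw [← dist_eq_norm]
        refine h₃ _ hs _ hr ?_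
        rw [Real.dist_eq, abs_of_nonneg (by linarith)]
        linarith) ht
  have hlast : ‖U (a t) (z t) - U t (z t)‖ ≤ η / 4 :=
    h₁ _ _ ((hat t ht).trans hn1) _ (mem_image_of_mem _ ht)
  change ‖U (a t) zn - u t‖ ≤ η
  calc ‖U (a t) zn - u t‖ = ‖U (a t) (zn - z t) + (U (a t) (z t) - U t (z t))‖ := by
        rw [hut, map_sub (U (a t)) zn (z t), sub_add_sub_cancel]
    _ ≤ ‖zn - z t‖ + ‖U (a t) (z t) - U t (z t)‖ := by
        rw [← hU.norm_map (a t) (zn - z t)]; exact norm_add_le _ _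
    _ ≤ (Mβ * η' * t + (Mβ + 1) * (t * η' + τ / n * K)) + η / 4 := add_le_add hdiff hlast
    _ ≤ 2 * ((Mβ + 1) * (T + 1) * η') + (Mβ + 1) * τ * K / n + η / 4 := by
        have e : (Mβ + 1) * (t * η' + τ / n * K) = (Mβ + 1) * t * η' + (Mβ + 1) * τ * K / n := by
          ring
        have htT : t ≤ T + 1 := by linarith [ht.2]
        have e2 : Mβ * η' * t ≤ (Mβ + 1) * (T + 1) * η' := by
          rw [mul_right_comm]
          gcongr
          · exact ht.1
          · linarith
        have e3 : (Mβ + 1) * t * η' ≤ (Mβ + 1) * (T + 1) * η' := by gcongr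
        rw [e]; linarith
    _ ≤ η := by
        have : (Mβ + 1) * (T + 1) * η' = η / 4 := by rw [hη']; field_simp
        rw [this]; linarith

end Convergence

/-! ### The group in the weaker norm -/

section Embedding

variable {H₀ H₁ : Type*}
  [NormedAddCommGroup H₀] [InnerProductSpace ℂ H₀]
  [NormedAddCommGroup H₁] [InnerProductSpace ℂ H₁]
  {ι : H₁ →L[ℂ] H₀} {A : H₁ →ₗ.[ℂ] H₁} {A₀ : H₀ →ₗ.[ℂ] H₀} {U : ℝ → H₁ →L[ℂ] H₁}

theorem LinearPMap.isFormalAdjoint_self_of_isSelfAdjoint [CompleteSpace H₀] (hA₀ : IsSelfAdjoint A₀) :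
    A₀.IsFormalAdjoint A₀ := by
  have := A₀.adjoint_isFormalAdjoint hA₀.dense_domain
  rwa [LinearPMap.isSelfAdjoint_def.1 hA₀] at this

/-- A self-adjoint operator in `H₀` whose domain contains `H₁` is bounded from `H₁` to `H₀`. -/
theorem exists_norm_apply_embedding_le [CompleteSpace H₀] [CompleteSpace H₁] (hA₀ : IsSelfAdjoint A₀)
    (hdom : ∀ x : H₁, ι x ∈ A₀.domain) :
    ∃ C : ℝ, 0 ≤ C ∧ ∀ x : H₁, ‖A₀ ⟨ι x, hdom x⟩‖ ≤ C * ‖x‖ := by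
  let g : H₁ →ₗ[ℂ] H₀ := A₀.toFun ∘ₗ (ι : H₁ →ₗ[ℂ] H₀).codRestrict A₀.domain hdom
  have hg : ∀ x, g x = A₀ ⟨ι x, hdom x⟩ := fun x => rfl
  have hcont : Continuous g := by
    refine g.continuous_of_seq_closed_graph fun u x y hu hgu => ?_
    -- Closed graph: testing against the dense domain moves `A₀` onto `z`, where only the
    -- convergence of `ι (u n)` is needed.
    refine hA₀.dense_domain.eq_of_inner_left ℂ fun z hz => ?_
    have h1 : Tendsto (fun n => inner ℂ (g (u n)) z) atTop (𝓝 (inner ℂ y z)) :=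
      hgu.inner tendsto_const_nhds
    have h2 : Tendsto (fun n => inner ℂ (ι (u n)) (A₀ ⟨z, hz⟩)) atTop
        (𝓝 (inner ℂ (ι x) (A₀ ⟨z, hz⟩))) :=
      ((ι.continuous.tendsto x).comp hu).inner tendsto_const_nhds
    have hsym := LinearPMap.isFormalAdjoint_self_of_isSelfAdjoint hA₀
    have h3 : ∀ w, inner ℂ (g w) z = inner ℂ (ι w) (A₀ ⟨z, hz⟩) := fun w =>
      hsym ⟨ι w, hdom w⟩ ⟨z, hz⟩
    rw [h3 x]
    simp only [h3] at h1
    exact tendsto_nhds_unique h1 h2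
  exact ⟨‖(⟨g, hcont⟩ : H₁ →L[ℂ] H₀)‖, norm_nonneg _, fun x =>
    (⟨g, hcont⟩ : H₁ →L[ℂ] H₀).le_opNorm x⟩

/-- `U t` commutes with the group, so applying it to the difference quotient at zero shows that it
preserves the domain of the generator. -/
theorem IsUnitaryGroupGeneratedBy.hasDerivAt (hU : IsUnitaryGroupGeneratedBy A U)
    {x y : H₁} (h : (x, y) ∈ A.graph) (t : ℝ) :
    (U t x, U t y) ∈ A.graph ∧ HasDerivAt (fun t => U t x) (-(Complex.I • U t y)) t := by
  have h0 := (hU.generator x y).1 h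
  have h1 : HasDerivAt (fun s => U t (U s x)) (-(Complex.I • U t y)) 0 := by
    have := ((U t).restrictScalars ℝ).hasFDerivAt.comp_hasDerivAt (0 : ℝ) h0
    simpa [Function.comp_def] using this
  constructor
  · rw [hU.generator]
    refine h1.congr_of_eventuallyEq (Eventually.of_forall fun s => ?_)
    simp only
    rw [← hU.map_add_apply, ← hU.map_add_apply, add_comm]
  · have h2 : HasDerivAt (fun s => U t (U (s - t) x)) (-(Complex.I • U t y)) t := by
      have h3 : HasDerivAt (fun s : ℝ => s - t) 1 t := (hasDerivAt_id t).sub_const t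
      have := HasDerivAt.scomp_of_eq (h := fun s : ℝ => s - t) t h1 h3 (by simp)
      simpa [Function.comp_def] using this
    refine h2.congr_of_eventuallyEq (Eventually.of_forall fun s => ?_)
    simp only
    rw [← hU.map_add_apply, add_sub_cancel]

variable (hdom : ∀ x : H₁, ι x ∈ A₀.domain)
  (hext : ∀ x : A.domain, A₀ ⟨ι (x : H₁), hdom x⟩ = ι (A x))

include hext in
theorem hasDerivAt_embedding (hU : IsUnitaryGroupGeneratedBy A U) (x : A.domain) (t : ℝ) :
    HasDerivAt (fun t => ι (U t x)) (-(Complex.I • A₀ ⟨ι (U t x), hdom _⟩)) t := by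
  have hx : ((x : H₁), A x) ∈ A.graph := A.mem_graph x
  obtain ⟨h1, h2⟩ := hU.hasDerivAt hx t
  obtain ⟨w, hw1, hw2⟩ := (LinearPMap.mem_graph_iff _).1 h1
  simp only at hw1 hw2
  have h3 : A₀ ⟨ι (U t x), hdom _⟩ = ι (U t (A x)) := by
    rw [← hw2, ← hext w]
    congr 1
    exact Subtype.ext (by rw [hw1])
  rw [h3]
  have := (ι.restrictScalars ℝ).hasFDerivAt.comp_hasDerivAt t h2
  simpa [Function.comp_def] using this

include hext in
-- For `x` in the domain of `A`, symmetry of `A₀` makes the derivative of $\|\iota U(t)x\|^2$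
-- vanish; density does the rest. No group on `H₀` has to be constructed.
theorem norm_embedding_unitary [CompleteSpace H₀] [CompleteSpace H₁] (hA : IsSelfAdjoint A) (hA₀ : IsSelfAdjoint A₀)
    (hU : IsUnitaryGroupGeneratedBy A U) (t : ℝ) (x : H₁) : ‖ι (U t x)‖ = ‖ι x‖ := by
  have hsym := LinearPMap.isFormalAdjoint_self_of_isSelfAdjoint hA₀
  refine hA.dense_domain.induction (P := fun x => ‖ι (U t x)‖ = ‖ι x‖) (fun x hx => ?_)
    (isClosed_eq (by fun_prop) (by fun_prop)) x
  have hd : ∀ t, HasDerivAt (fun t => inner ℂ (ι (U t x)) (ι (U t x))) 0 t := by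
    intro t
    have h1 := hasDerivAt_embedding hdom hext hU ⟨x, hx⟩ t
    refine (HasDerivAt.inner ℂ h1 h1).congr_deriv ?_
    set y : A₀.domain := ⟨ι (U t x), hdom _⟩
    have h3 : inner ℂ (A₀ y) (y : H₀) = inner ℂ (y : H₀) (A₀ y) := hsym y y
    change inner ℂ (y : H₀) (-(Complex.I • A₀ y)) + inner ℂ (-(Complex.I • A₀ y)) (y : H₀) = 0
    rw [inner_neg_right, inner_neg_left, inner_smul_right, inner_smul_left, h3, Complex.conj_I]
    ring
  have hc := is_const_of_deriv_eq_zero (fun t => (hd t).differentiableAt) (fun t => (hd t).deriv) t 0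
  simp only [hU.map_zero, ContinuousLinearMap.id_apply, inner_self_eq_norm_sq_to_K] at hc
  norm_cast at hc
  exact (pow_left_inj₀ (norm_nonneg _) (norm_nonneg _) two_ne_zero).1 hc

include hext in
-- The velocity in `H₀` is at most `C * ‖x‖`, with `C` a bound for `A₀ ∘ ι`, because `U` is
-- isometric on `H₁`. This is the source of the rate `1 / n`.
theorem exists_norm_embedding_sub_le [CompleteSpace H₀] [CompleteSpace H₁] (hA : IsSelfAdjoint A)
    (hA₀ : IsSelfAdjoint A₀) (hU : IsUnitaryGroupGeneratedBy A U) :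
    ∃ C : ℝ, 0 ≤ C ∧ ∀ (s t : ℝ) (x : H₁), ‖ι (U t x) - ι (U s x)‖ ≤ C * |t - s| * ‖x‖ := by
  obtain ⟨C, hC0, hC⟩ := exists_norm_apply_embedding_le hA₀ hdom
  refine ⟨C, hC0, fun s t x => ?_⟩
  refine hA.dense_domain.induction
    (P := fun x => ‖ι (U t x) - ι (U s x)‖ ≤ C * |t - s| * ‖x‖) (fun x hx => ?_)
    (isClosed_le (by fun_prop) (by fun_prop)) x
  have := convex_univ.norm_image_sub_le_of_norm_hasDerivWithin_le (x := s) (y := t)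
    (f := fun t => ι (U t x)) (C := C * ‖x‖)
    (fun r _ => (hasDerivAt_embedding hdom hext hU ⟨x, hx⟩ r).hasDerivWithinAt)
    (fun r _ => by
      rw [norm_neg, norm_smul, Complex.norm_I, one_mul]
      refine (hC _).trans ?_
      rw [hU.norm_map]) (mem_univ _) (mem_univ _)
  rw [Real.norm_eq_abs] at this
  linarith

end Embedding

/-! ### First-order convergence in the weaker norm -/

section LowNorm

variable {H₀ H₁ : Type*}
  [NormedAddCommGroup H₀] [InnerProductSpace ℂ H₀]
  [NormedAddCommGroup H₁] [InnerProductSpace ℂ H₁]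
  {ι : H₁ →L[ℂ] H₀} {A : H₁ →ₗ.[ℂ] H₁} {U : ℝ → H₁ →L[ℂ] H₁} {B : H₁ → H₁}
  {B' : H₁ → H₀ →L[ℝ] H₀}

theorem IsUniformH0Derivative.exists_lipschitz (hB' : IsUniformH0Derivative ι B B') {R : ℝ}
    (hR : 0 < R) : ∃ δ > (0 : ℝ), ∃ L ≥ (0 : ℝ), ∀ x y, ‖x‖ ≤ R → ‖y - x‖ ≤ δ →
      ‖ι (B y) - ι (B x)‖ ≤ L * ‖ι y - ι x‖ := by
  -- Tolerance one already suffices: the bound on `B'` plus one is a Lipschitz constant for the `H₀`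
  -- norm.
  obtain ⟨C, hC, δ, hδ, h⟩ := hB' R hR 1 one_pos
  refine ⟨δ / 2, by positivity, C + 1, by positivity, fun x y hx hy => ?_⟩
  obtain ⟨h1, h2⟩ := h x (y - x) hx (by linarith)
  rw [add_sub_cancel, map_sub] at h2
  have h3 := ((B' x).le_opNorm (ι y - ι x)).trans
    (mul_le_mul_of_nonneg_right h1 (norm_nonneg _))
  calc ‖ι (B y) - ι (B x)‖ = ‖(ι (B y) - ι (B x) - B' x (ι y - ι x)) + B' x (ι y - ι x)‖ := by
        rw [sub_add_cancel]
    _ ≤ 1 * ‖ι y - ι x‖ + C * ‖ι y - ι x‖ := (norm_add_le _ _).trans (add_le_add h2 h3)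
    _ = _ := by ring

/-- Solutions of the splitting equation that stay close to the exact solution approximate it to
first order in the weaker norm. -/
theorem exists_norm_embedding_sub_le_div [CompleteSpace H₀] [CompleteSpace H₁]
    (hU : IsUnitaryGroupGeneratedBy A U)
    (hiso : ∀ t x, ‖ι (U t x)‖ = ‖ι x‖) {C : ℝ} (hC : 0 ≤ C)
    (hlip : ∀ (s t : ℝ) (x : H₁), ‖ι (U t x) - ι (U s x)‖ ≤ C * |t - s| * ‖x‖)
    (hB : LocallyLipschitz B) (hB' : IsUniformH0Derivative ι B B')
    {τ : ℝ} {α β : ℝ → ℝ} (hτ : 0 < τ)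
    (hα : IsSplittingProfile τ α) (hβ : IsSplittingProfile τ β) {T : ℝ} (hT : 0 ≤ T) {u₀ : H₁}
    {u : ℝ → H₁} (hu : ContinuousOn u (Icc 0 T))
    (hu' : ∀ t ∈ Icc 0 T, u t = picardMap U B (fun t => t) (fun _ => 1) u₀ u t) :
    ∃ δ > (0 : ℝ), ∃ D : ℝ, 0 ≤ D ∧ ∃ n₀ : ℕ, ∀ n : ℕ, n₀ ≤ n → ∀ v : ℝ → H₁,
      ContinuousOn v (Icc 0 T) →
      (∀ t ∈ Icc 0 T, v t =
        picardMap U B (fun t => ∫ r in (0 : ℝ)..t, α (n * r)) (fun t => β (n * t)) u₀ v t) →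
      (∀ t ∈ Icc 0 T, ‖v t - u t‖ ≤ δ) → ∀ t ∈ Icc 0 T, ‖ι (v t) - ι (u t)‖ ≤ D / n := by
  obtain ⟨Mα, hMα⟩ := hα.bounded
  obtain ⟨Mβ, hMβ⟩ := hβ.bounded
  have hMα0 : 0 ≤ Mα := (abs_nonneg _).trans (hMα 0)
  have hMβ0 : 0 ≤ Mβ := (abs_nonneg _).trans (hMβ 0)
  have h0 : (0 : ℝ) ∈ Icc 0 T := ⟨le_rfl, hT⟩
  obtain ⟨R, hR⟩ := isCompact_Icc.exists_bound_of_continuousOn hu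
  have hR0 : 0 ≤ R := (norm_nonneg _).trans (hR 0 h0)
  have hg : ContinuousOn (fun s => B (u s)) (Icc 0 T) := hB.continuous.comp_continuousOn hu
  obtain ⟨K, hK⟩ := isCompact_Icc.exists_bound_of_continuousOn hg
  have hK0 : 0 ≤ K := (norm_nonneg _).trans (hK 0 h0)
  obtain ⟨δ₀, hδ₀, L₀, hL₀, hBι⟩ := hB'.exists_lipschitz (show 0 < R + 1 by positivity)
  replace hBι : ∀ t ∈ Icc 0 T, ∀ y, ‖y - u t‖ ≤ δ₀ →
      ‖ι (B y) - ι (B (u t))‖ ≤ L₀ * ‖ι y - ι (u t)‖ := fun t ht y hy =>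
    hBι (u t) y ((hR t ht).trans (by linarith)) hy
  obtain ⟨δ₁, hδ₁, L, hL, hBL⟩ :=
    hB.exists_lipschitz_near_isCompact (isCompact_Icc.image_of_continuousOn hu)
  -- Once `τ / n ≤ δ₂`, values of `u` within one period are `δ₀`-close in `H₁`, as the
  -- `H₀`-Lipschitz estimate for `B` requires.
  obtain ⟨δ₂, hδ₂, hunif⟩ := Metric.uniformContinuousOn_iff_le.1
    (isCompact_Icc.uniformContinuousOn_of_continuous hu) δ₀ hδ₀
  set z : ℝ → H₁ := fun t => u₀ - Complex.I • ∫ s in (0 : ℝ)..t, (1 : ℝ) • U (-s) (B (u s)) with hz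
  have hut : ∀ t ∈ Icc 0 T, u t = U t (z t) := hu'
  have hzR : ∀ t ∈ Icc 0 T, ‖z t‖ ≤ R := fun t ht => by
    rw [← hU.norm_map t, ← hut t ht]; exact hR t ht
  have hGc : ContinuousOn (fun s => U (-s) (B (u s))) (Icc 0 T) :=
    hU.continuousOn_comp continuous_neg.continuousOn hg
  have hI2 : ∀ s ∈ Icc 0 T, ∀ t ∈ Icc 0 T,
      IntervalIntegrable (fun s => (1 : ℝ) • U (-s) (B (u s))) volume s t := fun s hs t ht =>
    intervalIntegrable_picard hU continuous_id (β := fun _ => 1)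
      (fun _ _ => intervalIntegrable_const) hg hs ht
  -- With the free evolution removed, `z` is Lipschitz even in `H₁`; restoring the evolution costs
  -- the `H₁` norm and leaves `u` Lipschitz in `H₀`.
  have hzlip : ∀ s ∈ Icc 0 T, ∀ t ∈ Icc 0 T, s ≤ t → ‖z t - z s‖ ≤ K * (t - s) := by
    intro s hs t ht hst
    simp only [hz]
    rw [sub_sub_sub_cancel_left, ← smul_sub, norm_smul, Complex.norm_I, one_mul, norm_sub_rev,
      intervalIntegral.integral_interval_sub_left (hI2 _ h0 _ ht) (hI2 _ h0 _ hs)]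
    have := intervalIntegral.norm_integral_le_of_norm_le_const (a := s) (b := t)
      (C := K) (f := fun s => (1 : ℝ) • U (-s) (B (u s))) fun r hr => by
        rw [uIoc_of_le hst] at hr
        rw [one_smul, hU.norm_map]
        exact hK r ⟨hs.1.trans hr.1.le, hr.2.trans ht.2⟩
    rwa [abs_of_nonneg (by linarith)] at this
  have hulip : ∀ s ∈ Icc 0 T, ∀ t ∈ Icc 0 T, s ≤ t →
      ‖ι (u t) - ι (u s)‖ ≤ (‖ι‖ * K + C * R) * (t - s) := by
    intro s hs t ht hst
    calc ‖ι (u t) - ι (u s)‖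
        = ‖ι (U t (z t - z s)) + (ι (U t (z s)) - ι (U s (z s)))‖ := by
          rw [hut t ht, hut s hs, map_sub (U t) (z t) (z s),
            map_sub ι (U t (z t)) (U t (z s)), sub_add_sub_cancel]
      _ ≤ ‖ι (z t - z s)‖ + C * |t - s| * ‖z s‖ := by
          rw [← hiso t (z t - z s)]
          exact (norm_add_le _ _).trans (add_le_add le_rfl (hlip _ _ _))
      _ ≤ ‖ι‖ * (K * (t - s)) + C * (t - s) * R := by
          rw [abs_of_nonneg (by linarith)]
          have h1 := hzlip s hs t ht hst
          have h2 := hzR s hs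
          have h3 : 0 ≤ t - s := by linarith
          refine add_le_add ((ι.le_opNorm _).trans ?_) ?_ <;> gcongr
      _ = _ := by ring
  -- `Λ` bounds the `H₀` increments of $\Phi^A(-s)B(u(s))$ within one period, and `D₁` collects all
  -- errors of order `1 / n`.
  set Λ := L₀ * (‖ι‖ * K + C * R) + C * K with hΛ
  have hΛ0 : 0 ≤ Λ := by positivity
  set D₁ := Mβ * (C * ((Mα + 1) * τ) * (K + L * δ₁)) * T + (Mβ + 1) * (T * (Λ * τ) + τ * (‖ι‖ * K)) +
    C * ((Mα + 1) * τ) * R with hD₁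
  have hD₁0 : 0 ≤ D₁ := by positivity
  -- `δ₀` serves the `H₀` estimate for `B`, and `δ₁` bounds `B (v s)` in `H₁`. The added one keeps
  -- the Grönwall constant positive.
  refine ⟨min δ₀ δ₁, lt_min hδ₀ hδ₁, 2 * D₁ * Real.exp (2 * (Mβ * L₀ + 1) * T), by positivity, ?_⟩
  obtain ⟨n₀, hn₀⟩ := eventually_atTop.1 ((eventually_gt_atTop 0).and
    ((tendsto_const_div_atTop_nhds_zero_nat τ).eventually (ge_mem_nhds hδ₂)))
  refine ⟨n₀, fun n hn v hv hv' hvu => ?_⟩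
  obtain ⟨hn0, hn1⟩ := hn₀ n hn
  have hnpos : (0 : ℝ) < n := by positivity
  set a : ℝ → ℝ := fun t => ∫ r in (0 : ℝ)..t, α (n * r) with ha
  have hac : Continuous a :=
    intervalIntegral.continuous_primitive (hα.intervalIntegrable_comp_mul hn0) 0
  have hat : ∀ s ∈ Icc 0 T, |a s - s| ≤ (Mα + 1) * τ / n := fun s hs =>
    hα.abs_integral_sub_le hτ hMα hn0 hs.1
  have hβi := hβ.intervalIntegrable_comp_mul (n := n) hn0
  have hgv : ContinuousOn (fun s => B (v s)) (Icc 0 T) := hB.continuous.comp_continuousOn hv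
  have hKv : ∀ s ∈ Icc 0 T, ‖B (v s)‖ ≤ K + L * δ₁ := by
    intro s hs
    have hvs := (hvu s hs).trans (min_le_right _ _)
    have := hBL _ (mem_image_of_mem u hs) (v s) (u s) hvs (by simpa using hδ₁.le)
    calc ‖B (v s)‖ = ‖B (u s) + (B (v s) - B (u s))‖ := by rw [add_sub_cancel]
      _ ≤ K + L * δ₁ := (norm_add_le _ _).trans (add_le_add (hK s hs) (this.trans (by gcongr)))
  have hsub : ContinuousOn (fun t => ‖ι (v t) - ι (u t)‖) (Icc 0 T) :=
    ((ι.continuous.comp_continuousOn hv).sub (ι.continuous.comp_continuousOn hu)).norm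
  have key : ∀ t ∈ Icc 0 T, ‖ι (v t) - ι (u t)‖ ≤
      D₁ / n + (Mβ * L₀ + 1) * ∫ s in (0 : ℝ)..t, ‖ι (v s) - ι (u s)‖ := by
    intro t ht
    set zn : H₁ := u₀ - Complex.I • ∫ s in (0 : ℝ)..t, β (n * s) • U (-a s) (B (v s)) with hzn
    have hvt : v t = U (a t) zn := hv' t ht
    have hJ1 := intervalIntegrable_picard hU hac hβi hgv h0 ht
    have hJ2 := intervalIntegrable_picard hU continuous_id hβi hgv h0 ht
    have hJ3 := intervalIntegrable_picard hU continuous_id hβi hg h0 ht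
    have hJ4 := hI2 _ h0 _ ht
    simp only [id] at hJ2 hJ3
    -- `X₁` is the error of the propagator time, `X₂` the feedback of the solution error for
    -- Grönwall, and `X₃` the averaging error.
    set X₁ : ℝ → H₁ := fun s => β (n * s) • U (-a s) (B (v s)) - β (n * s) • U (-s) (B (v s)) with hX₁
    set X₂ : ℝ → H₁ := fun s => β (n * s) • U (-s) (B (v s)) - β (n * s) • U (-s) (B (u s)) with hX₂
    set X₃ : ℝ → H₁ := fun s => β (n * s) • U (-s) (B (u s)) - (1 : ℝ) • U (-s) (B (u s)) with hX₃
    have hX₁i : IntervalIntegrable X₁ volume 0 t := hJ1.sub hJ2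
    have hX₂i : IntervalIntegrable X₂ volume 0 t := hJ2.sub hJ3
    have hX₃i : IntervalIntegrable X₃ volume 0 t := hJ3.sub hJ4
    have e1 : zn - z t = -(Complex.I • ((∫ s in (0 : ℝ)..t, X₁ s) + (∫ s in (0 : ℝ)..t, X₂ s) +
        ∫ s in (0 : ℝ)..t, X₃ s)) := by
      rw [intervalIntegral.integral_sub hJ1 hJ2, intervalIntegral.integral_sub hJ2 hJ3,
        intervalIntegral.integral_sub hJ3 hJ4, hz, hzn]
      simp only [smul_sub, smul_add]
      abel
    have hsm : ∀ (c : ℝ) (x : H₁), ι (c • x) = c • ι x := fun c x =>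
      map_smul (ι.restrictScalars ℝ) c x
    have b1 : ‖ι (∫ s in (0 : ℝ)..t, X₁ s)‖ ≤ Mβ * (C * ((Mα + 1) * τ / n) * (K + L * δ₁)) * T := by
      rw [← ι.intervalIntegral_comp_comm hX₁i]
      have := intervalIntegral.norm_integral_le_of_norm_le_const (a := (0 : ℝ)) (b := t)
        (C := Mβ * (C * ((Mα + 1) * τ / n) * (K + L * δ₁))) (f := fun s => ι (X₁ s)) fun s hs => by
          rw [uIoc_of_le ht.1] at hs
          have hs' : s ∈ Icc 0 T := ⟨hs.1.le, hs.2.trans ht.2⟩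
          simp only [hX₁]
          rw [← smul_sub, hsm, map_sub, norm_smul]
          refine mul_le_mul (hMβ _) ((hlip _ _ _).trans ?_) (norm_nonneg _) hMβ0
          have e : |-a s - -s| = |a s - s| := by rw [neg_sub_neg, abs_sub_comm]
          rw [e]
          have := hat s hs'
          have := hKv s hs'
          gcongr
      rw [sub_zero, abs_of_nonneg ht.1] at this
      refine this.trans ?_
      have := ht.2
      gcongr
    have b2 : ‖ι (∫ s in (0 : ℝ)..t, X₂ s)‖ ≤
        Mβ * L₀ * ∫ s in (0 : ℝ)..t, ‖ι (v s) - ι (u s)‖ := by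
      rw [← ι.intervalIntegral_comp_comm hX₂i, ← intervalIntegral.integral_const_mul]
      refine intervalIntegral.norm_integral_le_of_norm_le ht.1 (ae_of_all _ fun s hs => ?_)
        (((hsub.mono (uIcc_subset_Icc h0 ht)).intervalIntegrable).const_mul _)
      have hs' : s ∈ Icc 0 T := ⟨hs.1.le, hs.2.trans ht.2⟩
      simp only [hX₂]
      rw [← smul_sub, ← map_sub, hsm, norm_smul, hiso, map_sub, mul_assoc]
      exact mul_le_mul (hMβ _) (hBι s hs' _ ((hvu s hs').trans (min_le_left _ _)))
        (norm_nonneg _) hMβ0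
    have b3 : ‖ι (∫ s in (0 : ℝ)..t, X₃ s)‖ ≤
        (Mβ + 1) * (T * (Λ * (τ / n)) + τ / n * (‖ι‖ * K)) := by
      rw [← ι.intervalIntegral_comp_comm hX₃i]
      have e : (fun s => ι (X₃ s)) = fun s => (β (n * s) - 1) • ι (U (-s) (B (u s))) := by
        ext s
        rw [hX₃, ← hsm, sub_smul]
      rw [e]
      have := hβ.norm_integral_sub_one_smul_le hτ hMβ hn0 (ι.continuous.comp_continuousOn hGc)
        (K := ‖ι‖ * K) (η := Λ * (τ / n)) (fun s hs => by
          simp only [Function.comp_apply]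
          rw [hiso]
          exact (ι.le_opNorm _).trans (by gcongr; exact hK s hs))
        (fun r hr s hs hrs hsr => by
          simp only [Function.comp_apply]
          have hsr' : s - r ≤ τ / n := by linarith
          have hclose : ‖u s - u r‖ ≤ δ₀ := by
            rw [← dist_eq_norm]
            refine hunif _ hs _ hr ?_
            rw [Real.dist_eq, abs_of_nonneg (by linarith)]
            linarith
          calc ‖ι (U (-s) (B (u s))) - ι (U (-r) (B (u r)))‖
              = ‖ι (U (-s) (B (u s) - B (u r))) +
                  (ι (U (-s) (B (u r))) - ι (U (-r) (B (u r))))‖ := by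
                rw [map_sub, map_sub, sub_add_sub_cancel]
            _ ≤ L₀ * ‖ι (u s) - ι (u r)‖ + C * |-s - -r| * ‖B (u r)‖ := by
                refine (norm_add_le _ _).trans (add_le_add ?_ (hlip _ _ _))
                rw [hiso, map_sub]
                exact hBι r hr _ hclose
            _ ≤ L₀ * ((‖ι‖ * K + C * R) * (s - r)) + C * (s - r) * K := by
                have h1 := hulip r hr s hs hrs
                have h2 := hK r hr
                have h3 : 0 ≤ s - r := by linarith
                rw [show |-s - -r| = s - r by
                  rw [neg_sub_neg, abs_sub_comm, abs_of_nonneg h3]]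
                gcongr
            _ = Λ * (s - r) := by rw [hΛ]; ring
            _ ≤ Λ * (τ / n) := by gcongr) ht
      refine this.trans ?_
      have := ht.2
      gcongr
    have hlast : ‖ι (U (a t) (z t)) - ι (U t (z t))‖ ≤ C * ((Mα + 1) * τ / n) * R := by
      refine (hlip _ _ _).trans ?_
      have := hat t ht
      have := hzR t ht
      gcongr
    have hint0 : 0 ≤ ∫ s in (0 : ℝ)..t, ‖ι (v s) - ι (u s)‖ :=
      intervalIntegral.integral_nonneg ht.1 fun _ _ => norm_nonneg _
    calc ‖ι (v t) - ι (u t)‖ = ‖ι (U (a t) (zn - z t)) + (ι (U (a t) (z t)) - ι (U t (z t)))‖ := by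
          rw [hvt, hut t ht, map_sub (U (a t)) zn (z t),
            map_sub ι (U (a t) zn) (U (a t) (z t)), sub_add_sub_cancel]
      _ ≤ ‖ι (zn - z t)‖ + C * ((Mα + 1) * τ / n) * R := by
          rw [← hiso (a t) (zn - z t)]
          exact (norm_add_le _ _).trans (add_le_add le_rfl hlast)
      _ ≤ (Mβ * (C * ((Mα + 1) * τ / n) * (K + L * δ₁)) * T +
            (Mβ * L₀ * ∫ s in (0 : ℝ)..t, ‖ι (v s) - ι (u s)‖) +
            (Mβ + 1) * (T * (Λ * (τ / n)) + τ / n * (‖ι‖ * K))) +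
            C * ((Mα + 1) * τ / n) * R := by
          refine add_le_add ?_ le_rfl
          rw [e1, map_neg, norm_neg, map_smul, norm_smul, Complex.norm_I, one_mul, map_add, map_add]
          exact norm_add₃_le.trans (add_le_add (add_le_add b1 b2) b3)
      _ = D₁ / n + (Mβ * L₀) * ∫ s in (0 : ℝ)..t, ‖ι (v s) - ι (u s)‖ := by
          rw [hD₁]; field_simp; ring
      _ ≤ _ := by gcongr; linarith
  intro t ht
  refine (le_of_le_add_integral hsub (fun _ _ => norm_nonneg _) (by positivity) key (by positivity)
    t ht).trans_eq ?_
  ring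

end LowNorm

/-! ### Exponentials of bounded skew-adjoint operators -/

section SkewExponential

variable {H : Type*} [NormedAddCommGroup H] [InnerProductSpace ℂ H] [CompleteSpace H]
  {X Y : H →L[ℂ] H}

theorem ContinuousLinearMap.exp_add_of_commute (h : Commute X Y) :
    NormedSpace.exp (X + Y) = NormedSpace.exp X * NormedSpace.exp Y := by
  let +nondep : NormedAlgebra ℚ (H →L[ℂ] H) := .restrictScalars ℚ ℂ (H →L[ℂ] H)
  exact NormedSpace.exp_add_of_commute h

theorem norm_exp_apply_of_star_eq_neg (hX : star X = -X) (x : H) :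
    ‖NormedSpace.exp X x‖ = ‖x‖ := by
  have h1 : star (NormedSpace.exp X) * NormedSpace.exp X = 1 := by
    rw [NormedSpace.star_exp, hX, ← ContinuousLinearMap.exp_add_of_commute (Commute.refl X).neg_left,
      neg_add_cancel, NormedSpace.exp_zero]
  have h2 : inner ℂ (NormedSpace.exp X x) (NormedSpace.exp X x) = inner ℂ x x := by
    rw [← ContinuousLinearMap.adjoint_inner_left, ← ContinuousLinearMap.star_eq_adjoint]
    change inner ℂ ((star (NormedSpace.exp X) * NormedSpace.exp X) x) x = _
    rw [h1]; rfl
  simp only [inner_self_eq_norm_sq_to_K] at h2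
  norm_cast at h2
  exact (pow_left_inj₀ (norm_nonneg _) (norm_nonneg _) two_ne_zero).1 h2

theorem star_real_smul_eq_neg (hX : star X = -X) (t : ℝ) : star (t • X) = -(t • X) := by
  rw [star_smul, hX, smul_neg]; rfl

theorem exp_add_smul_apply (X : H →L[ℂ] H) (s t : ℝ) (x : H) :
    NormedSpace.exp ((s + t) • X) x = NormedSpace.exp (s • X) (NormedSpace.exp (t • X) x) := by
  rw [add_smul, ContinuousLinearMap.exp_add_of_commute
    (((Commute.refl X).smul_left s).smul_right t)]
  rfl

theorem hasDerivAt_exp_smul_apply (X : H →L[ℂ] H) (x : H) (t : ℝ) :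
    HasDerivAt (fun t : ℝ => NormedSpace.exp (t • X) x) (NormedSpace.exp (t • X) (X x)) t := by
  have h := hasDerivAt_exp_smul_const (𝕂 := ℝ) X t
  exact (((ContinuousLinearMap.apply ℂ H x).restrictScalars ℝ).hasFDerivAt.comp_hasDerivAt t h :)

theorem norm_exp_smul_apply_sub_le (hX : star X = -X) (t : ℝ) (x : H) :
    ‖NormedSpace.exp (t • X) x - x‖ ≤ |t| * ‖X x‖ := by
  have := convex_univ.norm_image_sub_le_of_norm_hasDerivWithin_le (x := (0 : ℝ)) (y := t)
    (f := fun t : ℝ => NormedSpace.exp (t • X) x) (C := ‖X x‖)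
    (fun r _ => (hasDerivAt_exp_smul_apply X x r).hasDerivWithinAt)
    (fun r _ => (norm_exp_apply_of_star_eq_neg (star_real_smul_eq_neg hX r) _).le)
    (mem_univ _) (mem_univ _)
  simpa [mul_comm] using this

theorem norm_exp_smul_apply_sub_sub_le {t c : ℝ} {x : H}
    (hc : ∀ s : ℝ, |s| ≤ |t| → ‖NormedSpace.exp (s • X) (X x) - X x‖ ≤ c) :
    ‖NormedSpace.exp (t • X) x - x - t • X x‖ ≤ c * |t| := by
  have := (convex_Icc (-|t|) |t|).norm_image_sub_le_of_norm_hasDerivWithin_le (x := (0 : ℝ)) (y := t)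
    (f := fun s : ℝ => NormedSpace.exp (s • X) x - s • X x) (C := c)
    (f' := fun s => NormedSpace.exp (s • X) (X x) - (1 : ℝ) • X x)
    (fun r _ => ((hasDerivAt_exp_smul_apply X x r).sub
      ((hasDerivAt_id r).smul_const (X x))).hasDerivWithinAt)
    (fun r hr => by rw [one_smul]; exact hc r (abs_le.2 hr))
    ⟨by simp, by simp⟩ ⟨neg_abs_le t, le_abs_self t⟩
  simp only [zero_smul, NormedSpace.exp_zero, sub_zero, one_apply_eq_self,
    Real.norm_eq_abs] at this
  rwa [sub_right_comm]

/-- Commutation gives $e^{tX}=e^{tY}e^{t(X-Y)}$ with $e^{tY}$ isometric. Strong convergence of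
generators thus passes to the exponentials. -/
theorem norm_exp_smul_apply_sub_exp_le (hX : star X = -X) (hY : star Y = -Y) (hXY : Commute X Y)
    (t : ℝ) (x : H) :
    ‖NormedSpace.exp (t • X) x - NormedSpace.exp (t • Y) x‖ ≤ |t| * ‖X x - Y x‖ := by
  have h1 : NormedSpace.exp (t • X) x =
      NormedSpace.exp (t • Y) (NormedSpace.exp (t • (X - Y)) x) := by
    have hc : Commute (t • Y) (t • (X - Y)) :=
      ((hXY.symm.sub_right (Commute.refl Y)).smul_left t).smul_right t
    have := ContinuousLinearMap.exp_add_of_commute hc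
    rw [← smul_add, add_sub_cancel] at this
    rw [this]; rfl
  rw [h1, ← map_sub, norm_exp_apply_of_star_eq_neg (star_real_smul_eq_neg hY t)]
  refine norm_exp_smul_apply_sub_le ?_ t x
  rw [star_sub, hX, hY]; abel

end SkewExponential

/-! ### Resolvents and Stone's theorem -/

section Stone

variable {H : Type*} [NormedAddCommGroup H] [InnerProductSpace ℂ H] [CompleteSpace H]
  {A : H →ₗ.[ℂ] H}

theorem IsSelfAdjoint.mem_graph_iff (hA : IsSelfAdjoint A) (p : H × H) :
    p ∈ A.graph ↔ ∀ a b, (a, b) ∈ A.graph → inner ℂ b p.1 = inner ℂ a p.2 := by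
  have h := LinearPMap.adjoint_graph_eq_graph_adjoint hA.dense_domain
  rw [LinearPMap.isSelfAdjoint_def.1 hA] at h
  conv_lhs => rw [h]
  simp only [Submodule.mem_adjoint_iff, sub_eq_zero]

/-- $\langle Ax,x\rangle$ is real, so the cross term with `l * I` vanishes. -/
theorem IsSelfAdjoint.norm_sq_add_eq (hA : IsSelfAdjoint A) {p : H × H} (hp : p ∈ A.graph)
    (l : ℝ) : ‖p.2 + ((l : ℂ) * Complex.I) • p.1‖ ^ 2 = ‖p.2‖ ^ 2 + l ^ 2 * ‖p.1‖ ^ 2 := by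
  have h := (hA.mem_graph_iff p).1 hp p.1 p.2 hp
  have him : (inner ℂ p.2 p.1).im = 0 := by
    have h2 := congrArg Complex.im (h.trans (inner_conj_symm p.1 p.2).symm)
    rw [Complex.conj_im] at h2
    linarith
  rw [norm_add_sq (𝕜 := ℂ), norm_smul, inner_smul_right, mul_pow]
  simp [him]

theorem IsSelfAdjoint.abs_mul_norm_le (hA : IsSelfAdjoint A) {p : H × H} (hp : p ∈ A.graph)
    (l : ℝ) : |l| * ‖p.1‖ ≤ ‖p.2 + ((l : ℂ) * Complex.I) • p.1‖ := by
  refine abs_le_of_sq_le_sq' ?_ (norm_nonneg _) |>.2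
  rw [hA.norm_sq_add_eq hp, mul_pow, sq_abs]
  nlinarith [sq_nonneg ‖p.2‖]

theorem IsSelfAdjoint.norm_snd_le (hA : IsSelfAdjoint A) {p : H × H} (hp : p ∈ A.graph)
    (l : ℝ) : ‖p.2‖ ≤ ‖p.2 + ((l : ℂ) * Complex.I) • p.1‖ := by
  refine abs_le_of_sq_le_sq' ?_ (norm_nonneg _) |>.2
  rw [hA.norm_sq_add_eq hp]
  nlinarith [mul_nonneg (sq_nonneg l) (sq_nonneg ‖p.1‖)]

/-- The resolvent `(A + i l)⁻¹` of a self-adjoint operator. -/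
theorem IsSelfAdjoint.exists_resolvent (hA : IsSelfAdjoint A) {l : ℝ} (hl : l ≠ 0) :
    ∃ R : H →L[ℂ] H, (∀ x, (R x, x - ((l : ℂ) * Complex.I) • R x) ∈ A.graph) ∧
      ∀ x y, (x, y) ∈ A.graph → R (y + ((l : ℂ) * Complex.I) • x) = x := by
  set c : ℂ := (l : ℂ) * Complex.I with hc
  have hlpos : 0 < |l| := abs_pos.2 hl
  -- `A + i l` is treated as a bounded operator on the graph, which is complete because `A` is
  -- closed. It is bounded below there, hence injective with closed range.
  let S : A.graph →L[ℂ] H :=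
    (ContinuousLinearMap.snd ℂ H H + c • ContinuousLinearMap.fst ℂ H H).comp A.graph.subtypeL
  have hS : ∀ p : A.graph, S p = (p : H × H).2 + c • (p : H × H).1 := fun p => rfl
  have hcomplete : CompleteSpace A.graph :=
    (show IsClosed (A.graph : Set (H × H)) from hA.isClosed).completeSpace_coe
  have hanti : AntilipschitzWith (Real.toNNReal (1 + |l|⁻¹)) S := by
    refine S.antilipschitz_of_bound fun p => ?_
    change ‖p‖ ≤ _ * ‖S p‖
    rw [Real.coe_toNNReal _ (by positivity), hS]
    have h1 := hA.abs_mul_norm_le p.2 l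
    have h2 := hA.norm_snd_le p.2 l
    rw [← hc] at h1 h2
    set N := ‖(p : H × H).2 + c • (p : H × H).1‖
    have hN : 0 ≤ N := norm_nonneg _
    rw [Submodule.coe_norm, Prod.norm_def, add_mul, one_mul]
    refine max_le ?_ (h2.trans (le_add_of_nonneg_right (by positivity)))
    rw [mul_comm, ← le_div_iff₀ hlpos, div_eq_inv_mul] at h1
    exact h1.trans (le_add_of_nonneg_left hN)
  have hclosed : IsClosed (S.range : Set H) := by
    have := hanti.isClosed_range S.uniformContinuous
    rwa [← S.coe_coe, ← LinearMap.coe_range] at this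
  have hrange : S.range = ⊤ := by
    have : CompleteSpace S.range := hclosed.completeSpace_coe
    rw [← Submodule.orthogonal_eq_bot_iff, Submodule.eq_bot_iff]
    intro w hw
    -- A vector orthogonal to the range would be an eigenvector of `A` with the imaginary eigenvalue
    -- `c`, which the lower bound at `-l` excludes.
    have hmem : (w, c • w) ∈ A.graph := by
      rw [hA.mem_graph_iff]
      intro a b hab
      have h1 : inner ℂ (S ⟨(a, b), hab⟩) w = 0 := hw _ ⟨_, rfl⟩
      rw [hS] at h1
      simp only [inner_add_left, inner_smul_left] at h1
      rw [inner_smul_right]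
      have h2 : (starRingEnd ℂ) c = -c := by simp [hc]
      rw [h2] at h1
      linear_combination h1
    have := hA.abs_mul_norm_le hmem (-l)
    simp only [Complex.ofReal_neg, neg_mul, neg_smul, ← hc, add_neg_cancel, norm_zero, abs_neg] at this
    exact norm_le_zero_iff.1 (nonpos_of_mul_nonpos_right this hlpos)
  have hker : S.ker = ⊥ := LinearMap.ker_eq_bot.2 hanti.injective
  let e := ContinuousLinearEquiv.ofBijective S hker hrange
  refine ⟨((ContinuousLinearMap.fst ℂ H H).comp A.graph.subtypeL).comp (e.symm : H →L[ℂ] A.graph),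
    fun x => ?_, fun x y hxy => ?_⟩
  · have h1 : S (e.symm x) = x := ContinuousLinearEquiv.ofBijective_apply_symm_apply S hker hrange x
    have h2 : x - c • (e.symm x : H × H).1 = (e.symm x : H × H).2 := by
      rw [hS] at h1
      rw [sub_eq_iff_eq_add, h1]
    change ((e.symm x : H × H).1, x - c • (e.symm x : H × H).1) ∈ A.graph
    rw [h2]
    exact (e.symm x).2
  · have h1 : e.symm (S ⟨(x, y), hxy⟩) = ⟨(x, y), hxy⟩ :=
      ContinuousLinearEquiv.ofBijective_symm_apply_apply S hker hrange _
    change (e.symm (S ⟨(x, y), hxy⟩) : H × H).1 = x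
    rw [h1]

/-- `R l` is the resolvent `(A + i l)⁻¹` for all real `l ≠ 0`. -/
structure IsResolventFamily (A : H →ₗ.[ℂ] H) (R : ℝ → H →L[ℂ] H) : Prop where
  mem_graph : ∀ l : ℝ, l ≠ 0 → ∀ x, (R l x, x - ((l : ℂ) * Complex.I) • R l x) ∈ A.graph
  apply_add : ∀ l : ℝ, l ≠ 0 → ∀ x y, (x, y) ∈ A.graph → R l (y + ((l : ℂ) * Complex.I) • x) = x

theorem IsSelfAdjoint.exists_isResolventFamily (hA : IsSelfAdjoint A) :
    ∃ R : ℝ → H →L[ℂ] H, IsResolventFamily A R := by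
  have h : ∀ l : ℝ, ∃ R : H →L[ℂ] H, l ≠ 0 →
      (∀ x, (R x, x - ((l : ℂ) * Complex.I) • R x) ∈ A.graph) ∧
        ∀ x y, (x, y) ∈ A.graph → R (y + ((l : ℂ) * Complex.I) • x) = x := by
    intro l
    by_cases hl : l = 0
    · exact ⟨0, fun h => absurd hl h⟩
    · obtain ⟨R, hR⟩ := hA.exists_resolvent hl
      exact ⟨R, fun _ => hR⟩
  choose R hR using h
  exact ⟨R, fun l hl => (hR l hl).1, fun l hl => (hR l hl).2⟩

omit [CompleteSpace H] in
theorem tendsto_zero_of_dense {κ : Type*} {f : Filter κ} {T : κ → H →L[ℂ] H} {C : ℝ} (hC : 0 ≤ C)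
    (hT : ∀ i x, ‖T i x‖ ≤ C * ‖x‖) {s : Set H} (hs : Dense s)
    (h : ∀ x ∈ s, Tendsto (fun i => T i x) f (𝓝 0)) (x : H) : Tendsto (fun i => T i x) f (𝓝 0) := by
  rw [Metric.tendsto_nhds]
  intro ε hε
  obtain ⟨y, hy, hxy⟩ := hs.exists_dist_lt x (ε := ε / (2 * (C + 1))) (by positivity)
  filter_upwards [Metric.tendsto_nhds.1 (h y hy) (ε / 2) (by positivity)] with i hi
  rw [dist_zero_right] at hi ⊢
  rw [dist_eq_norm, lt_div_iff₀ (by positivity)] at hxy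
  calc ‖T i x‖ = ‖T i (x - y) + T i y‖ := by rw [map_sub, sub_add_cancel]
    _ ≤ C * ‖x - y‖ + ‖T i y‖ := (norm_add_le _ _).trans (add_le_add (hT _ _) le_rfl)
    _ < ε := by nlinarith [norm_nonneg (x - y)]

namespace IsResolventFamily

variable {R : ℝ → H →L[ℂ] H}

theorem abs_mul_norm_le (hR : IsResolventFamily A R) (hA : IsSelfAdjoint A) {l : ℝ} (hl : l ≠ 0)
    (x : H) : |l| * ‖R l x‖ ≤ ‖x‖ := by
  simpa using hA.abs_mul_norm_le (hR.mem_graph l hl x) l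

omit [CompleteSpace H] in
theorem sub_eq (hR : IsResolventFamily A R) {l m : ℝ} (hl : l ≠ 0) (hm : m ≠ 0) (x : H) :
    R l x + (((l : ℂ) - m) * Complex.I) • R l (R m x) = R m x := by
  have := hR.apply_add l hl _ _ (hR.mem_graph m hm x)
  rw [← map_smul, ← map_add]
  convert this using 2
  module

omit [CompleteSpace H] in
theorem commute (hR : IsResolventFamily A R) {l m : ℝ} (hl : l ≠ 0) (hm : m ≠ 0) :
    Commute (R l) (R m) := by
  rcases eq_or_ne l m with rfl | hlm
  · exact Commute.refl _
  ext x
  change R l (R m x) = R m (R l x)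
  have h1 := hR.sub_eq hl hm x
  have h2 := hR.sub_eq hm hl x
  have hne : ((l : ℂ) - m) * Complex.I ≠ 0 :=
    mul_ne_zero (sub_ne_zero.2 (by exact_mod_cast hlm)) Complex.I_ne_zero
  have h3 : (((l : ℂ) - m) * Complex.I) • (R l (R m x) - R m (R l x)) = 0 := by
    have e : (((l : ℂ) - m) * Complex.I) • (R l (R m x) - R m (R l x)) =
        (R l x + (((l : ℂ) - m) * Complex.I) • R l (R m x)) +
        (R m x + (((m : ℂ) - l) * Complex.I) • R m (R l x)) - R l x - R m x := by module
    rw [e, h1, h2]; abel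
  exact sub_eq_zero.1 ((smul_eq_zero.1 h3).resolve_left hne)

theorem star_eq (hR : IsResolventFamily A R) (hA : IsSelfAdjoint A) {l : ℝ} (hl : l ≠ 0) :
    star (R l) = R (-l) := by
  rw [ContinuousLinearMap.star_eq_adjoint, eq_comm, ContinuousLinearMap.eq_adjoint_iff]
  intro x y
  have h := (hA.mem_graph_iff _).1 (hR.mem_graph l hl y) _ _ (hR.mem_graph (-l) (neg_ne_zero.2 hl) x)
  simp only [inner_sub_left, inner_sub_right, inner_smul_left, inner_smul_right, map_mul,
    map_neg, Complex.conj_I, Complex.conj_ofReal, Complex.ofReal_neg] at h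
  linear_combination -h

/-- On the domain $ilR_l y-y=-R_lAy=O(1/|l|)$; the uniform bound extends the limit to all vectors.
-/
theorem tendsto_smul_apply (hR : IsResolventFamily A R) (hA : IsSelfAdjoint A) {l : ℕ → ℝ}
    (hl : ∀ n, l n ≠ 0) (h : Tendsto (fun n => |l n|) atTop atTop) (x : H) :
    Tendsto (fun n => ((l n : ℂ) * Complex.I) • R (l n) x) atTop (𝓝 x) := by
  have hbound : ∀ n x, ‖((l n : ℂ) * Complex.I) • R (l n) x‖ ≤ ‖x‖ := fun n x => by
    rw [norm_smul]
    simpa using hR.abs_mul_norm_le hA (hl n) x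
  have key := tendsto_zero_of_dense (f := atTop) (C := 2)
    (T := fun n => ((l n : ℂ) * Complex.I) • R (l n) - ContinuousLinearMap.id ℂ H) (by norm_num)
    (fun n x => by
      have := hbound n x
      change ‖((l n : ℂ) * Complex.I) • R (l n) x - x‖ ≤ 2 * ‖x‖
      linarith [norm_sub_le (((l n : ℂ) * Complex.I) • R (l n) x) x]) hA.dense_domain
    (fun y hy => by
      have hG := A.mem_graph ⟨y, hy⟩
      have e : ∀ n, (((l n : ℂ) * Complex.I) • R (l n) - ContinuousLinearMap.id ℂ H) y =
          -(R (l n) (A ⟨y, hy⟩)) := fun n => by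
        have := hR.apply_add (l n) (hl n) _ _ hG
        rw [map_add, map_smul] at this
        change ((l n : ℂ) * Complex.I) • R (l n) y - y = _
        rw [sub_eq_iff_eq_add, ← sub_eq_neg_add]
        exact eq_sub_of_add_eq' this
      simp only [e]
      rw [tendsto_zero_iff_norm_tendsto_zero]
      refine squeeze_zero (fun _ => norm_nonneg _) (fun n => ?_)
        (h.const_div_atTop ‖A ⟨y, hy⟩‖)
      rw [norm_neg, le_div_iff₀ (abs_pos.2 (hl n)), mul_comm]
      exact hR.abs_mul_norm_le hA (hl n) _) x
  have := key.add_const x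
  simpa using this

end IsResolventFamily

/-- Bounded skew-adjoint approximations of `-iA`. -/
def yosidaApprox (R : ℝ → H →L[ℂ] H) (l : ℝ) : H →L[ℂ] H :=
  (-(Complex.I * (l ^ 2 / 2))) • (R l + R (-l))

namespace IsResolventFamily

variable {R : ℝ → H →L[ℂ] H}

theorem star_yosidaApprox (hR : IsResolventFamily A R) (hA : IsSelfAdjoint A) {l : ℝ}
    (hl : l ≠ 0) : star (yosidaApprox R l) = -yosidaApprox R l := by
  rw [yosidaApprox, star_smul, star_add, hR.star_eq hA hl, hR.star_eq hA (neg_ne_zero.2 hl),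
    neg_neg, ← neg_smul, add_comm]
  congr 1
  simp

omit [CompleteSpace H] in
theorem commute_yosidaApprox (hR : IsResolventFamily A R) {l m : ℝ} (hl : l ≠ 0) (hm : m ≠ 0) :
    Commute (yosidaApprox R l) (yosidaApprox R m) := by
  have hl' := neg_ne_zero.2 hl
  have hm' := neg_ne_zero.2 hm
  refine Commute.smul_left (Commute.smul_right ?_ _) _
  exact ((hR.commute hl hm).add_right (hR.commute hl hm')).add_left
    ((hR.commute hl' hm).add_right (hR.commute hl' hm'))

omit [CompleteSpace H] in
-- Formally the approximation is $-il^2A(A^2+l^2)^{-1}$; pairing `l` with `-l` makes it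
-- skew-adjoint. In this form each summand tends to `y`.
theorem yosidaApprox_apply (hR : IsResolventFamily A R) {l : ℝ} (hl : l ≠ 0) {x y : H}
    (h : (x, y) ∈ A.graph) : yosidaApprox R l x = (-(Complex.I / 2)) •
      (((l : ℂ) * Complex.I) • R l y + (((-l : ℝ) : ℂ) * Complex.I) • R (-l) y) := by
  have h1 := hR.apply_add l hl x y h
  have h2 := hR.apply_add (-l) (neg_ne_zero.2 hl) x y h
  rw [map_add, map_smul] at h1 h2
  rw [eq_sub_of_add_eq h1, eq_sub_of_add_eq h2, yosidaApprox]
  change (-(Complex.I * (l ^ 2 / 2))) • (R l x + R (-l) x) = _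
  simp only [smul_sub, smul_add, smul_smul, Complex.ofReal_neg]
  match_scalars <;> ring_nf <;> simp <;> ring

theorem tendsto_yosidaApprox (hR : IsResolventFamily A R) (hA : IsSelfAdjoint A) {x y : H}
    (h : (x, y) ∈ A.graph) :
    Tendsto (fun n : ℕ => yosidaApprox R (n + 1) x) atTop (𝓝 (-(Complex.I • y))) := by
  have hne : ∀ n : ℕ, (n + 1 : ℝ) ≠ 0 := fun n => by positivity
  have ht : Tendsto (fun n : ℕ => (n + 1 : ℝ)) atTop atTop :=
    tendsto_atTop_add_const_right _ _ tendsto_natCast_atTop_atTop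
  have h1 := hR.tendsto_smul_apply hA hne (tendsto_abs_atTop_atTop.comp ht) y
  have h2 := hR.tendsto_smul_apply hA (l := fun n : ℕ => -(n + 1 : ℝ))
    (fun n => neg_ne_zero.2 (hne n))
    (by simpa only [abs_neg, Function.comp_def] using tendsto_abs_atTop_atTop.comp ht) y
  have h3 := (h1.add h2).const_smul (-(Complex.I / 2))
  have e : (-(Complex.I / 2)) • (y + y) = -(Complex.I • y) := by module
  rw [e] at h3
  exact h3.congr fun n => (hR.yosidaApprox_apply (hne n) h).symm

end IsResolventFamily

/-- **Stone's theorem**: a self-adjoint operator generates a strongly continuous unitary group. -/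
theorem IsSelfAdjoint.exists_isUnitaryGroupGeneratedBy (hA : IsSelfAdjoint A) :
    ∃ U : ℝ → H →L[ℂ] H, IsUnitaryGroupGeneratedBy A U := by
  obtain ⟨R, hR⟩ := hA.exists_isResolventFamily
  set X : ℕ → H →L[ℂ] H := fun n => yosidaApprox R (n + 1) with hXdef
  have hne : ∀ n : ℕ, (n + 1 : ℝ) ≠ 0 := fun n => by positivity
  have hX : ∀ n, star (X n) = -X n := fun n => hR.star_yosidaApprox hA (hne n)
  have hXc : ∀ m n, Commute (X m) (X n) := fun m n => hR.commute_yosidaApprox (hne m) (hne n)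
  have hXt : ∀ x y, (x, y) ∈ A.graph → Tendsto (fun n => X n x) atTop (𝓝 (-(Complex.I • y))) :=
    fun x y h => hR.tendsto_yosidaApprox hA h
  set V : ℕ → ℝ → H →L[ℂ] H := fun n t => NormedSpace.exp (t • X n) with hVdef
  have hVn : ∀ n t x, ‖V n t x‖ = ‖x‖ := fun n t x =>
    norm_exp_apply_of_star_eq_neg (star_real_smul_eq_neg (hX n) t) x
  have hcauchy : ∀ t x, CauchySeq fun n => V n t x := by
    intro t x
    rw [cauchySeq_iff_tendsto_dist_atTop_0]
    have := tendsto_zero_of_dense (f := atTop) (C := 2) (T := fun n : ℕ × ℕ => V n.1 t - V n.2 t)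
      (by norm_num) (fun n x => by
        change ‖V n.1 t x - V n.2 t x‖ ≤ 2 * ‖x‖
        refine (norm_sub_le _ _).trans ?_
        rw [hVn, hVn, two_mul]) hA.dense_domain
      (fun y hy => by
        have hc := cauchySeq_iff_tendsto_dist_atTop_0.1
          (hXt _ _ (A.mem_graph ⟨y, hy⟩)).cauchySeq
        rw [tendsto_zero_iff_norm_tendsto_zero]
        refine squeeze_zero (fun _ => norm_nonneg _) (fun n => ?_)
          (by simpa using hc.const_mul |t|)
        rw [dist_eq_norm]
        exact norm_exp_smul_apply_sub_exp_le (hX _) (hX _) (hXc _ _) t y) x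
    simpa [dist_eq_norm] using this.norm
  have hlim : ∀ t, ∃ U : H →L[ℂ] H, ∀ x, Tendsto (fun n => V n t x) atTop (𝓝 (U x)) := by
    intro t
    choose f hf using fun x => cauchySeq_tendsto_of_complete (hcauchy t x)
    exact ⟨continuousLinearMapOfTendsto (fun n => V n t) (tendsto_pi_nhds.2 hf), hf⟩
  choose U hU using hlim
  have hnorm : ∀ t x, ‖U t x‖ = ‖x‖ := fun t x =>
    tendsto_nhds_unique (hU t x).norm (by simp only [hVn]; exact tendsto_const_nhds)
  have hzero : U 0 = ContinuousLinearMap.id ℂ H := by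
    ext x
    refine tendsto_nhds_unique (hU 0 x) ?_
    simp [hVdef, NormedSpace.exp_zero]
  have hadd : ∀ s t, U (s + t) = (U s).comp (U t) := by
    intro s t
    ext x
    refine tendsto_nhds_unique (hU (s + t) x) ?_
    simp only [hVdef, exp_add_smul_apply]
    have h1 : Tendsto (fun n => V n s (V n t x - U t x)) atTop (𝓝 0) := by
      rw [tendsto_zero_iff_norm_tendsto_zero]
      simp only [hVn]
      exact tendsto_iff_norm_sub_tendsto_zero.1 (hU t x)
    simpa [hVdef] using h1.add (hU s (U t x))
  have hlip : ∀ x y, (x, y) ∈ A.graph → ∀ t, ‖U t x - x‖ ≤ |t| * ‖y‖ := by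
    intro x y h t
    have h1 := (hXt x y h).norm.const_mul |t|
    rw [norm_neg, norm_smul, Complex.norm_I, one_mul] at h1
    exact le_of_tendsto_of_tendsto' ((hU t x).sub_const x).norm h1 fun n =>
      norm_exp_smul_apply_sub_le (hX n) t x
  have hcont : ∀ x, Continuous fun t => U t x := by
    intro x
    refine continuous_of_uniform_approx_of_continuous fun u hu => ?_
    obtain ⟨ε, hε, hεu⟩ := Metric.mem_uniformity_dist.1 hu
    obtain ⟨y, hy, hxy⟩ := hA.dense_domain.exists_dist_lt x hε
    refine ⟨fun t => U t y, ?_, fun t => hεu ?_⟩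
    · refine (LipschitzWith.of_dist_le_mul (K := ‖A ⟨y, hy⟩‖₊) fun s t => ?_).continuous
      have e : U s y - U t y = U t (U (s - t) y - y) := by
        rw [map_sub, ← ContinuousLinearMap.comp_apply, ← hadd, add_sub_cancel]
      rw [dist_eq_norm, e, hnorm, mul_comm, Real.dist_eq]
      exact hlip _ _ (A.mem_graph ⟨y, hy⟩) _
    · rw [dist_eq_norm, ← map_sub, hnorm, ← dist_eq_norm]
      exact hxy
  have hderiv : ∀ x y, (x, y) ∈ A.graph →
      HasDerivAt (fun t => U t x) (-(Complex.I • y)) 0 := by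
    intro x y h
    -- `y` need not lie in the domain, so it is approximated by `z` that does: there $e^{sX_n}z-z$
    -- is $O(s)$ uniformly in large `n`.
    have key : ∀ z w, (z, w) ∈ A.graph → ∀ t,
        ‖U t x - x - t • -(Complex.I • y)‖ ≤ (|t| * ‖w‖ + 2 * ‖y - z‖) * |t| := by
      intro z w hzw t
      have hc : ∀ n, ‖V n t x - x - t • X n x‖ ≤
          (2 * ‖X n x - -(Complex.I • y)‖ + (|t| * ‖X n z‖ + 2 * ‖y - z‖)) * |t| := by
        intro n
        refine norm_exp_smul_apply_sub_sub_le fun s hs => ?_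
        have e : V n s (X n x) - X n x = (V n s (X n x - -(Complex.I • y)) -
            (X n x - -(Complex.I • y))) - Complex.I • ((V n s z - z) + (V n s (y - z) - (y - z))) := by
          simp only [map_sub, map_neg, map_smul]
          module
        change ‖V n s (X n x) - X n x‖ ≤ _
        rw [e]
        refine (norm_sub_le _ _).trans (add_le_add ?_ ?_)
        · refine (norm_sub_le _ _).trans ?_
          rw [hVn, two_mul]
        · rw [norm_smul, Complex.norm_I, one_mul]
          refine (norm_add_le _ _).trans (add_le_add ?_ ?_)
          · exact (norm_exp_smul_apply_sub_le (hX n) s z).trans (by gcongr)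
          · refine (norm_sub_le _ _).trans ?_
            rw [hVn, two_mul]
      have l1 : Tendsto (fun n => ‖V n t x - x - t • X n x‖) atTop
          (𝓝 ‖U t x - x - t • -(Complex.I • y)‖) :=
        (((hU t x).sub_const x).sub ((hXt x y h).const_smul t)).norm
      have l2 := (((tendsto_iff_norm_sub_tendsto_zero.1 (hXt x y h)).const_mul 2).add
        (((hXt z w hzw).norm.const_mul |t|).add_const (2 * ‖y - z‖))).mul_const |t|
      rw [norm_neg, norm_smul, Complex.norm_I, one_mul, mul_zero, zero_add] at l2
      exact le_of_tendsto_of_tendsto' l1 l2 hc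
    rw [hasDerivAt_iff_isLittleO, Asymptotics.isLittleO_iff]
    intro c hc
    obtain ⟨z, hz, hyz⟩ := hA.dense_domain.exists_dist_lt y (ε := c / 4) (by positivity)
    set w := A ⟨z, hz⟩
    have hev : ∀ᶠ t : ℝ in 𝓝 0, |t| * ‖w‖ < c / 2 := by
      have : Continuous fun t : ℝ => |t| * ‖w‖ := by fun_prop
      exact (this.tendsto 0).eventually (gt_mem_nhds (by simpa using hc))
    filter_upwards [hev] with t ht
    rw [hzero, sub_zero, Real.norm_eq_abs]
    refine (key z w (A.mem_graph ⟨z, hz⟩) t).trans ?_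
    rw [dist_eq_norm] at hyz
    gcongr
    linarith
  refine ⟨U, hzero, hadd, hnorm, hcont, fun x y => ⟨hderiv x y, fun h => ?_⟩⟩
  -- The generator is no larger than `A`: differentiating the constant $\langle U(t)a,U(t)x\rangle$
  -- at zero gives the relation that characterises the graph of a self-adjoint operator.
  rw [hA.mem_graph_iff]
  intro a b hab
  have h1 := HasDerivAt.inner ℂ (hderiv a b hab) h
  have h2 : (fun t => inner ℂ (U t a) (U t x)) = fun _ => inner ℂ a x := by
    ext t
    exact (⟨(U t).toLinearMap, hnorm t⟩ : H →ₗᵢ[ℂ] H).inner_map_map a x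
  rw [h2] at h1
  have h3 := h1.unique (hasDerivAt_const _ _)
  simp only [hzero, ContinuousLinearMap.id_apply, inner_neg_right, inner_neg_left,
    inner_smul_right, inner_smul_left, Complex.conj_I] at h3
  have h4 : Complex.I * (inner ℂ b x - inner ℂ a y) = 0 := by linear_combination h3
  exact sub_eq_zero.1 ((mul_eq_zero.1 h4).resolve_left Complex.I_ne_zero)

theorem isUnitaryGroupGeneratedBy_unitaryGroup (hA : IsSelfAdjoint A) :
    IsUnitaryGroupGeneratedBy A (unitaryGroup A) := by
  rw [unitaryGroup, dif_pos hA.exists_isUnitaryGroupGeneratedBy]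
  exact hA.exists_isUnitaryGroupGeneratedBy.choose_spec

end Stone

/-! ### The interpolation inequality -/

section Interpolation

variable {H₀ H₁ : Type*}
  [NormedAddCommGroup H₀] [InnerProductSpace ℂ H₀]
  [NormedAddCommGroup H₁] [InnerProductSpace ℂ H₁]

/-- The interpolation inequality, up to a constant. -/
theorem interpolationENorm_embedding_le (ι : H₁ →L[ℂ] H₀) (hι : Function.Injective ι) {θ : ℝ}
    (hθ : θ ∈ Ioo (0 : ℝ) 1) (x : H₁) :
    interpolationENorm ι θ (ι x) ≤
      ENNReal.ofReal (Real.exp 1 * ‖ι x‖ ^ (1 - θ) * ‖x‖ ^ θ) := by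
  obtain ⟨hθ0, hθ1⟩ := hθ
  rcases eq_or_ne x 0 with rfl | hx
  · refine iInf₂_le_of_le 0 ⟨fun _ => 0, fun _ => 0, ?_, by simp⟩ (by simp)
    constructor <;> simp [continuousOn_const, continuous_const, differentiableOn_const]
    exact ⟨0, fun _ _ _ => le_rfl⟩
  have hx0 : 0 < ‖x‖ := norm_pos_iff.2 hx
  have hιx0 : 0 < ‖ι x‖ := norm_pos_iff.2 fun h => hx (hι (h.trans (map_zero ι).symm))
  -- The competitor is $\varphi(z)\,\iota x$ with $\varphi(\theta)=1$. The factor $e^{(z-\theta)l}$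
  -- balances the two boundary norms, $e^{z^2}$ forces decay along the strip, and the constant `e`
  -- is the price of $e^{z^2}$ on $\operatorname{Re}z=1$.
  set l : ℝ := Real.log (‖ι x‖ / ‖x‖) with hl
  have hl' : ‖ι x‖ = Real.exp l * ‖x‖ := by
    rw [hl, Real.exp_log (by positivity), div_mul_cancel₀ _ hx0.ne']
  set M : ℝ := Real.exp 1 * ‖ι x‖ ^ (1 - θ) * ‖x‖ ^ θ with hM
  have hM0 : 0 ≤ M := by positivity
  have hM' : M = Real.exp (1 + (1 - θ) * l) * ‖x‖ := by
    rw [hM, hl', Real.mul_rpow (Real.exp_pos _).le hx0.le, ← Real.exp_mul, mul_assoc, mul_assoc,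
      ← Real.rpow_add hx0, Real.exp_add, mul_assoc, mul_comm l]
    simp
  set φ : ℂ → ℂ := fun z => Complex.exp (z ^ 2 - θ ^ 2 + (z - θ) * l) with hφ
  have hφd : Differentiable ℂ φ := by fun_prop
  have hφn : ∀ z : ℂ, ‖φ z‖ =
      Real.exp (z.re ^ 2 - θ ^ 2 + (z.re - θ) * l) * Real.exp (-z.im ^ 2) := by
    intro z
    rw [hφ, Complex.norm_exp, ← Real.exp_add]
    congr 1
    simp only [sq, Complex.add_re, Complex.sub_re, Complex.mul_re, Complex.ofReal_re,
      Complex.ofReal_im, Complex.sub_im]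
    ring
  have hgauss : Tendsto (fun t : ℝ => Real.exp (-t ^ 2)) (cocompact ℝ) (𝓝 0) := by
    refine Real.tendsto_exp_neg_atTop_nhds_zero.comp ?_
    have := (tendsto_pow_atTop two_ne_zero).comp (tendsto_norm_cocompact_atTop (E := ℝ))
    simpa [Function.comp_def] using this
  have hgauss1 : ∀ t : ℝ, Real.exp (-t ^ 2) ≤ 1 := fun t => by
    rw [Real.exp_le_one_iff]; nlinarith [sq_nonneg t]
  have h0 : ∀ t : ℝ, ‖φ (t * Complex.I)‖ = Real.exp (-θ ^ 2 - θ * l) * Real.exp (-t ^ 2) := by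
    intro t
    rw [hφn]
    simp
    ring_nf
  have h1 : ∀ t : ℝ, ‖φ (1 + t * Complex.I)‖ =
      Real.exp (1 - θ ^ 2 + (1 - θ) * l) * Real.exp (-t ^ 2) := by
    intro t
    rw [hφn]
    simp
  refine iInf₂_le_of_le M.toNNReal ⟨fun z => φ z • ι x, fun t => φ (1 + t * Complex.I) • x,
    ?_, ?_⟩ le_rfl
  swap
  · simp [hφ]
  rw [Real.coe_toNNReal _ hM0]
  exact {
    continuousOn := (hφd.continuous.smul continuous_const).continuousOn
    bounded := by
      refine ⟨Real.exp (1 + |l|) * ‖ι x‖, fun z hz0 hz1 => ?_⟩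
      rw [norm_smul, hφn]
      refine mul_le_mul_of_nonneg_right ?_ (norm_nonneg _)
      refine (mul_le_of_le_one_right (Real.exp_pos _).le (hgauss1 _)).trans ?_
      rw [Real.exp_le_exp]
      have : (z.re - θ) * l ≤ |l| := by
        refine (le_abs_self _).trans ?_
        rw [abs_mul]
        refine mul_le_of_le_one_left (abs_nonneg _) ?_
        rw [abs_le]; constructor <;> linarith
      nlinarith [sq_nonneg θ]
    holomorphic := (hφd.smul_const _).differentiableOn
    boundary_one := fun t => (map_smul ι _ _).symm
    continuous_one := by
      have : Continuous fun t : ℝ => φ (1 + t * Complex.I) := hφd.continuous.comp (by fun_prop)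
      exact this.smul continuous_const
    tendsto_zero := by
      rw [tendsto_zero_iff_norm_tendsto_zero]
      simp only [norm_smul, h0]
      simpa using (hgauss.const_mul (Real.exp (-θ ^ 2 - θ * l))).mul_const ‖ι x‖
    tendsto_one := by
      rw [tendsto_zero_iff_norm_tendsto_zero]
      simp only [norm_smul, h1]
      simpa using (hgauss.const_mul (Real.exp (1 - θ ^ 2 + (1 - θ) * l))).mul_const ‖x‖
    norm_zero_le := by
      intro t
      rw [norm_smul, h0, hM', hl', ← mul_assoc]
      refine mul_le_mul_of_nonneg_right ?_ (norm_nonneg _)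
      rw [mul_right_comm, ← Real.exp_add]
      refine (mul_le_of_le_one_right (Real.exp_pos _).le (hgauss1 _)).trans ?_
      rw [Real.exp_le_exp]
      nlinarith [sq_nonneg θ]
    norm_one_le := by
      intro t
      rw [norm_smul, h1, hM']
      refine mul_le_mul_of_nonneg_right ?_ (norm_nonneg _)
      refine (mul_le_of_le_one_right (Real.exp_pos _).le (hgauss1 _)).trans ?_
      rw [Real.exp_le_exp]
      nlinarith [sq_nonneg θ] }

end Interpolation

/-! ### The flow and its solutions -/

section Flow

variable {H : Type*} [NormedAddCommGroup H] [InnerProductSpace ℂ H]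
  {A : H →ₗ.[ℂ] H} {B : H → H} {α β : ℝ → ℝ} {u₀ : H} {T : ℝ} {u : ℝ → H}

theorem IsMildSolutionOn.mono (hu : IsMildSolutionOn A B α β u₀ T u) {t : ℝ} (ht : t ≤ T) :
    IsMildSolutionOn A B α β u₀ t u :=
  ⟨hu.continuousOn.mono (Icc_subset_Icc_right ht), fun s hs =>
    hu.duhamel s (Icc_subset_Icc_right ht hs)⟩

/-- `flow` chooses a solution separately for each `t`; uniqueness on `[0, t]` identifies them all
with `u`. -/
theorem IsMildSolutionOn.flow_eq [CompleteSpace H] (hu : IsMildSolutionOn A B α β u₀ T u)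
    (hU : IsUnitaryGroupGeneratedBy A (unitaryGroup A))
    (hα : ∀ s t, IntervalIntegrable α volume s t) (hβ : ∀ s t, IntervalIntegrable β volume s t)
    {M : ℝ} (hM : ∀ t, |β t| ≤ M) (hB : LocallyLipschitz B) {t : ℝ} (ht : t ∈ Icc 0 T) :
    flow A B α β t u₀ = u t := by
  have h : ∃ u, IsMildSolutionOn A B α β u₀ t u := ⟨u, hu.mono ht.2⟩
  rw [flow, dif_pos h]
  obtain ⟨h1, h2⟩ := (isMildSolutionOn_iff hU hα hβ hB.continuous).1 h.choose_spec
  obtain ⟨h3, h4⟩ := (isMildSolutionOn_iff hU hα hβ hB.continuous).1 (hu.mono ht.2)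
  have hM0 : 0 ≤ M := (abs_nonneg _).trans (hM 0)
  exact eqOn_of_eq_picardMap hU (intervalIntegral.continuous_primitive hα 0) hβ (M := M + 1)
    (fun t => (hM t).trans (by linarith)) (by linarith) hB h1 h3 h2 h4 ⟨ht.1, le_rfl⟩

theorem IsMildSolutionOn.le_existenceTime {T : ℝ≥0} (hu : IsMildSolutionOn A B α β u₀ T u) :
    (T : ℝ≥0∞) ≤ existenceTime A B α β u₀ :=
  le_iSup₂_of_le T ⟨u, hu⟩ le_rfl

end Flow

end
-- Conclusion by interpolation
theorem mainTheorem6 {H₀ H₁ : Type*}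
    [NormedAddCommGroup H₀] [InnerProductSpace ℂ H₀] [CompleteSpace H₀]
    [NormedAddCommGroup H₁] [InnerProductSpace ℂ H₁] [CompleteSpace H₁]
    (ι : H₁ →L[ℂ] H₀) (hι : Function.Injective ι)
    (A : H₁ →ₗ.[ℂ] H₁) (hA : IsSelfAdjoint A)
    (A₀ : H₀ →ₗ.[ℂ] H₀) (hA₀ : IsSelfAdjoint A₀)
    (hdom : ∀ x : H₁, ι x ∈ A₀.domain)
    (hext : ∀ x : A.domain, A₀ ⟨ι (x : H₁), hdom x⟩ = ι (A x))
    (B : H₁ → H₁) (hB : LocallyLipschitz B)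
    (B' : H₁ → H₀ →L[ℝ] H₀) (hB' : IsUniformH0Derivative ι B B')
    (τ : ℝ) (hτ : 0 < τ) (α β : ℝ → ℝ)
    (hα : IsSplittingProfile τ α) (hβ : IsSplittingProfile τ β)
    (θ : ℝ) (hθ : θ ∈ Ioo (0 : ℝ) 1)
    (u₀ : H₁) (T : ℝ) (hT : 0 < T) (hTmax : ENNReal.ofReal T < exactExistenceTime A B u₀)
    (ε : ℝ) (hε : 0 < ε) :
    ∃ n₀ : ℕ, ∀ n : ℕ, n₀ ≤ n →
      ENNReal.ofReal T < splittingExistenceTime A B α β n u₀ ∧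
      ∀ k : ℕ, k ≤ n →
        interpolationENorm ι θ
          (ι (exactFlow A B (k * (T / n)) u₀ - splittingFlow A B α β n (k * (T / n)) u₀)) ≤
          ENNReal.ofReal (ε * (T / n) ^ (1 - θ)) := by
  have hU := isUnitaryGroupGeneratedBy_unitaryGroup hA
  -- Working on `[0, T']` with `T' > T` makes the inequality for the splitting existence time
  -- strict.
  obtain ⟨T', hT'⟩ := lt_iSup_iff.1 hTmax
  obtain ⟨⟨u, hu⟩, hTT'⟩ := lt_iSup_iff.1 hT'
  have hTT : T < T' := by
    rwa [← ENNReal.ofReal_coe_nnreal, ENNReal.ofReal_lt_ofReal_iff_of_nonneg hT.le] at hTT'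
  have hT0 : (0 : ℝ) ≤ T' := T'.coe_nonneg
  have hone : ∀ s t : ℝ, IntervalIntegrable (fun _ : ℝ => (1 : ℝ)) volume s t :=
    fun _ _ => intervalIntegrable_const
  obtain ⟨huc, hu'⟩ := (isMildSolutionOn_iff hU hone hone hB.continuous).1 hu
  simp only [integral_one, sub_zero] at hu'
  obtain ⟨C, hC0, hlip⟩ := exists_norm_embedding_sub_le hdom hext hA hA₀ hU
  obtain ⟨δ₀, hδ₀, D, hD, n₁, hn₁⟩ := exists_norm_embedding_sub_le_div hU
    (norm_embedding_unitary hdom hext hA hA₀ hU) hC0 hlip hB hB' hτ hα hβ hT0 huc hu'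
  obtain ⟨δ₁, hδ₁, L, hL, hBL⟩ :=
    hB.exists_lipschitz_near_isCompact (isCompact_Icc.image_of_continuousOn huc)
  obtain ⟨Mβ, hMβ⟩ := hβ.bounded
  have hMβ0 : 0 ≤ Mβ := (abs_nonneg _).trans (hMβ 0)
  have h1θ : 0 < 1 - θ := by linarith [hθ.2]
  -- `κ` is the `H₁` tolerance solving $e\,(D+1)^{1-\theta}\kappa^\theta=\varepsilon T^{1-\theta}$;
  -- `D + 1` avoids dividing by zero.
  set κ : ℝ := (ε * T ^ (1 - θ) / (Real.exp 1 * (D + 1) ^ (1 - θ))) ^ θ⁻¹ with hκ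
  have hκ0 : 0 < κ := by positivity
  have hκθ : κ ^ θ = ε * T ^ (1 - θ) / (Real.exp 1 * (D + 1) ^ (1 - θ)) := by
    rw [hκ, Real.rpow_inv_rpow (by positivity) hθ.1.ne']
  -- `δ₀` admits the `H₀` estimate, `δ₁` is the Lipschitz tube for Picard iteration, and `κ` yields
  -- the final constant.
  set δ := min (min δ₀ δ₁) κ with hδ
  have hδpos : 0 < δ := lt_min (lt_min hδ₀ hδ₁) hκ0
  set η : ℝ := δ / (2 * Real.exp (2 * ((Mβ + 1) * L) * T')) with hη
  have hηδ : 2 * η * Real.exp (2 * ((Mβ + 1) * L) * T') = δ := by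
    rw [hη]; field_simp
  obtain ⟨n₂, hn₂⟩ := exists_norm_picardMap_sub_le hU hB.continuous hτ hα hβ hT0 huc hu'
    (show 0 < η by positivity)
  refine ⟨max (max n₁ n₂) 1, fun n hn => ?_⟩
  have hn1 : n₁ ≤ n := (le_max_left _ _).trans ((le_max_left _ _).trans hn)
  have hn2 : n₂ ≤ n := (le_max_right _ _).trans ((le_max_left _ _).trans hn)
  have hn0 : 0 < n := (le_max_right _ _).trans hn
  have hnpos : (0 : ℝ) < n := by positivity
  have hαi := hα.intervalIntegrable_comp_mul (n := n) hn0
  have hβi := hβ.intervalIntegrable_comp_mul (n := n) hn0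
  obtain ⟨v, hvc, hv, hvu⟩ := exists_eq_picardMap hU
    (intervalIntegral.continuous_primitive hαi 0) hβi (M := Mβ + 1) (L := L) (δ := δ₁)
    (fun t => (hMβ _).trans (by linarith)) (by linarith) hL hB.continuous hT0 huc
    (fun t ht => hBL _ (mem_image_of_mem u ht)) (hn₂ n hn2)
    (hηδ.le.trans ((min_le_left _ _).trans (min_le_right _ _)))
  rw [hηδ] at hvu
  have hvm : IsMildSolutionOn A B (fun s => α (n * s)) (fun s => β (n * s)) u₀ T' v :=
    (isMildSolutionOn_iff hU hαi hβi hB.continuous).2 ⟨hvc, hv⟩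
  refine ⟨hTT'.trans_le hvm.le_existenceTime, fun k hk => ?_⟩
  have ht : (k * (T / n) : ℝ) ∈ Icc 0 (T' : ℝ) := by
    refine ⟨by positivity, le_trans ?_ hTT.le⟩
    rw [mul_div_left_comm]
    refine mul_le_of_le_one_right hT.le ((div_le_one hnpos).2 (by exact_mod_cast hk))
  rw [exactFlow, splittingFlow, hu.flow_eq hU hone hone (M := 1) (by simp) hB ht,
    hvm.flow_eq hU hαi hβi (fun t => hMβ _) hB ht]
  set t : ℝ := k * (T / n)
  have b0 : ‖ι (u t - v t)‖ ≤ (D + 1) / n := by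
    rw [map_sub, norm_sub_rev]
    refine (hn₁ n hn1 v hvc hv (fun t ht =>
      (hvu t ht).trans ((min_le_left _ _).trans (min_le_left _ _))) t ht).trans ?_
    gcongr
    linarith
  have b1 : ‖u t - v t‖ ≤ κ := by
    rw [norm_sub_rev]
    exact (hvu t ht).trans (min_le_right _ _)
  refine (interpolationENorm_embedding_le ι hι hθ _).trans (ENNReal.ofReal_le_ofReal ?_)
  have hθ0 := hθ.1.le
  calc Real.exp 1 * ‖ι (u t - v t)‖ ^ (1 - θ) * ‖u t - v t‖ ^ θ
      ≤ Real.exp 1 * ((D + 1) / n) ^ (1 - θ) * κ ^ θ := by gcongr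
    _ = ε * (T / n) ^ (1 - θ) := by
        rw [hκθ, Real.div_rpow (by positivity) hnpos.le, Real.div_rpow hT.le hnpos.le]
        have : (D + 1) ^ (1 - θ) ≠ 0 := by positivity
        field_simp
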